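/- Work in complex projective space $\mathbb{P}^3=\mathbb{P}(\mathbb{C}^4)$ and $\mathbb{P}^2=\mathbb{P}(\mathbb{C}^3)$. A camera is a real $3\times 4$ matrix $P$ of rank 3, seen as a rational map $\mathbb{P}^3\dashrightarrow\mathbb{P}^2$; its center is the point $\ker P$. Tuples of cameras always have pairwise distinct centers. For a tuple $\mathbf{P}=(P_1,\dots,P_n)$ let $\phi_{\mathbf P}:\mathbb{P}^3\dashrightarrow(\mathbb{P}^2)^n$, $x\mapsto(P_1x,\dots,P_nx)$, and call $z\in(\mathbb{P}^2)^n$ an image of $x\in\mathbb{P}^3$ if $(x,z)$ lies in the closure of the graph of $\phi_{\mathbf P}$, i.e. if for each $i$ either $P_ix=0$ or $z_i=[P_ix]$. A configuration $(\mathbf P,X)$, $X\subseteq\mathbb{P}^3$ any set of points, is a reconstruction of $S\subseteq(\mathbb{P}^2)^n$ if every $z\in S$ is an image of some $x\in X$ and every $x\in X$ has an image in $S$ (if $X$ contains no camera center this means $S=\phi_{\mathbf P}(X)$). Two configurations $(\mathbf P,X)$, $(\mathbf Q,Y)$ are equivalent if there is $H\in \mathrm{PGL}(4,\mathbb{R})$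 with $H(X)=Y$ and $P_iH^{-1}=Q_i$ (up to scale) for all $i$; they are conjugate if they are nonequivalent reconstructions of the same set $S$. The conjugate $(\mathbf Q,Y)$ is non-trivial if for all $i\ne j$ the fundamental matrices of $(P_i,P_j)$ and of $(Q_i,Q_j)$ are different (up to scale), where the fundamental matrix of $(P_i,P_j)$ is the matrix of the bilinear form $(u,v)\mapsto\det\begin{bmatrix}P_i&u&0\\P_j&0&v\end{bmatrix}$. A configuration is critical if it has a non-trivial conjugate. A (real) twisted cubic is the image of $[s:t]\mapsto[s^3:s^2t:st^2:t^3]$, $[s:t]\in\mathbb{P}^1(\mathbb{C})$, under a real projective transformation of $\mathbb{P}^3$; a (real) rational quartic is the image of $\mathbb{P}^1(\mathbb{C})$ under $[f_0:f_1:f_2:f_3]$, where the $f_i$ are linearly independent real binary quartic forms without a common zero over $\mathbb{C}$. Proposition. Let $\mathbf P=(P_1,P_2,P_3)$ be three cameras whose (distinct) centers lie on a line $L\subset\mathbb{P}^3$, and let $C\subset\mathbb{P}^3$ be a twisted cubic with $C\cap L=\emptyset$. Then: (1) for every set of points $X\subseteq C$, the configuration $(\mathbf P,X)$ is critical; (2)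 $(\mathbf P,C)$ has a non-trivial conjugate $(\mathbf Q,R)$ such that for every $X\subseteq C$ there is $Y\subseteq R$ for which $(\mathbf Q,Y)$ is a non-trivial conjugate of $(\mathbf P,X)$; (3) for every conjugate $(\mathbf Q,R)$ of $(\mathbf P,C)$, the set $R$ is a rational quartic curve containing the three centers of the cameras $Q_1,Q_2,Q_3$. -/

import Mathlib

open scoped LinearAlgebra.Projectivization Matrix

noncomputable section

/-- Complex projective 3-space, the space of space points. -/
abbrev Space : Type := ℙ ℂ (Fin 4 → ℂ)

/-- The complex projective plane, the space of image points. -/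
abbrev Image : Type := ℙ ℂ (Fin 3 → ℂ)

/-- A real matrix regarded as a complex matrix. -/
abbrev Matrix.toComplex {m n : Type*} (A : Matrix m n ℝ) : Matrix m n ℂ :=
  A.map (algebraMap ℝ ℂ)

/-- A (real projective pinhole) camera: a real `3 × 4` matrix of full rank. -/
structure Camera where
  mat : Matrix (Fin 3) (Fin 4) ℝ
  full_rank : mat.rank = 3

theorem Camera.finrank_ker (P : Camera) :
    Module.finrank ℂ (LinearMap.ker P.mat.toComplex.mulVecLin) = 1 := by
  have hs : LinearMap.range P.mat.mulVecLin = ⊤ := by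
    apply Submodule.eq_top_of_finrank_eq
    have h := P.full_rank
    rw [Matrix.rank] at h
    rw [h]; simp
  have hsurj : Function.Surjective P.mat.mulVec := LinearMap.range_eq_top.mp hs
  obtain ⟨B, hB⟩ := Matrix.mulVec_surjective_iff_exists_right_inverse.mp hsurj
  have hBC : P.mat.toComplex * B.toComplex = 1 := by
    rw [Matrix.toComplex, Matrix.toComplex, ← Matrix.map_mul, hB]
    exact Matrix.map_one _ (map_zero _) (map_one _)
  have hsC : LinearMap.range P.mat.toComplex.mulVecLin = ⊤ :=
    LinearMap.range_eq_top.mpr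
      (Matrix.mulVec_surjective_iff_exists_right_inverse.mpr ⟨_, hBC⟩)
  have h := LinearMap.finrank_range_add_finrank_ker P.mat.toComplex.mulVecLin
  rw [hsC, finrank_top] at h
  simp only [Module.finrank_fin_fun] at h
  omega

/-- The camera center: the point of projective 3-space given by the kernel of the camera matrix. -/
def Camera.center (P : Camera) : Space :=
  Projectivization.mk'' (LinearMap.ker P.mat.toComplex.mulVecLin) P.finrank_ker

/-- An `n`-tuple of cameras, with pairwise distinct camera centers. -/
structure CameraTuple (n : ℕ) where
  cam : Fin n → Camera
  distinct_centers : Function.Injective fun i => (cam i).center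

/-- `P.Sees x z`: the `n`-tuple of image points `z` is an image of the space point `x` under the
joint camera map of `P`, that is, `(x, z)` lies in the closure of the graph of the joint camera map
`x ↦ (P₁ x, …, Pₙ x)`. If `x` is no camera center, this says `z i = [Pᵢ x]` for all `i`; if
`x` is the center of the `i`-th camera, then `z i` is arbitrary and `z j = [Pⱼ x]` for `j ≠ i`. -/
def CameraTuple.Sees {n : ℕ} (P : CameraTuple n) (x : Space) (z : Fin n → Image) : Prop :=
  ∀ i, ∃ c : ℂ, (P.cam i).mat.toComplex *ᵥ x.rep = c • (z i).rep

/-- The configuration `(P, X)` of cameras and points is a reconstruction of the set `S` of image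
tuples. When `X` contains no camera center, this says that `S` is the image of `X` under the joint
camera map. A camera center in `X` may account for any image tuple in the closure of the graph. -/
def IsReconstruction {n : ℕ} (S : Set (Fin n → Image)) (P : CameraTuple n) (X : Set Space) :
    Prop :=
  (∀ z ∈ S, ∃ x ∈ X, P.Sees x z) ∧ ∀ x ∈ X, ∃ z ∈ S, P.Sees x z

/-- The real projective transformation of complex projective 3-space given by an invertible
real matrix. -/
def projTransform (H : GL (Fin 4) ℝ) : Space → Space :=
  Projectivization.map H.val.toComplex.mulVecLin (by
    have h : (H⁻¹).val.toComplex * H.val.toComplex = 1 := by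
      rw [Matrix.toComplex, Matrix.toComplex, ← Matrix.map_mul, ← Units.val_mul,
        inv_mul_cancel, Units.val_one]
      exact Matrix.map_one _ (map_zero _) (map_one _)
    intro v w hvw
    have h2 := congrArg (fun u => (H⁻¹).val.toComplex *ᵥ u) hvw
    simpa [Matrix.mulVec_mulVec, h] using h2)

/-- The condition `Pᵢ H⁻¹ = Qᵢ` for all `i`, as an equality of camera matrices up to scale. -/
def CamerasEquivVia {n : ℕ} (H : GL (Fin 4) ℝ) (P Q : CameraTuple n) : Prop :=
  ∀ i, ∃ c : ℝ, c ≠ 0 ∧ (P.cam i).mat * (H⁻¹).val = c • (Q.cam i).mat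

/-- Equivalence of configurations of cameras and points under the projective linear group. -/
def ConfigEquiv {n : ℕ} (P : CameraTuple n) (X : Set Space) (Q : CameraTuple n) (Y : Set Space) :
    Prop :=
  ∃ H : GL (Fin 4) ℝ, projTransform H '' X = Y ∧ CamerasEquivVia H P Q

/-- `(P, X)` and `(Q, Y)` are conjugate configurations: nonequivalent reconstructions of the same
set of image tuples. -/
def IsConjugate {n : ℕ} (P : CameraTuple n) (X : Set Space) (Q : CameraTuple n) (Y : Set Space) :
    Prop :=
  (∃ S : Set (Fin n → Image), IsReconstruction S P X ∧ IsReconstruction S Q Y) ∧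
    ¬ ConfigEquiv P X Q Y

/-- The bilinear form of the fundamental matrix of a pair of cameras `P`, `P'`:
`(u, v) ↦ det [P, u, 0; P', 0, v]`. -/
def fundamentalForm (P P' : Camera) (u v : Fin 3 → ℝ) : ℝ :=
  Matrix.det (Matrix.reindex finSumFinEquiv finSumFinEquiv
    (Matrix.fromBlocks P.mat (Matrix.of fun k (l : Fin 2) => if l = 0 then u k else 0)
      P'.mat (Matrix.of fun k (l : Fin 2) => if l = 0 then 0 else v k)) :
    Matrix (Fin 6) (Fin 6) ℝ)

/-- The fundamental matrices of the pairs `(P₁, P₂)` and `(Q₁, Q₂)` agree up to scale. -/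
def SameFundamental (P₁ P₂ Q₁ Q₂ : Camera) : Prop :=
  ∃ c : ℝ, c ≠ 0 ∧ ∀ u v, fundamentalForm P₁ P₂ u v = c * fundamentalForm Q₁ Q₂ u v

/-- A conjugate that witnesses non-trivial criticality: for every pair of views the
fundamental matrices on the two sides are different. -/
def IsNontrivialConjugate {n : ℕ} (P : CameraTuple n) (X : Set Space) (Q : CameraTuple n)
    (Y : Set Space) : Prop :=
  IsConjugate P X Q Y ∧
    ∀ i j, i ≠ j → ¬ SameFundamental (P.cam i) (P.cam j) (Q.cam i) (Q.cam j)

/-- `(P, X)` is a (non-trivial) critical configuration. -/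
def IsCritical {n : ℕ} (P : CameraTuple n) (X : Set Space) : Prop :=
  ∃ (Q : CameraTuple n) (Y : Set Space), IsNontrivialConjugate P X Q Y

/-- The vector `(s^d, s^(d-1) t, …, t^d)` of monomials of degree `d`. -/
def monomialVec (d : ℕ) (s t : ℂ) : Fin (d + 1) → ℂ :=
  fun k => s ^ (d - (k : ℕ)) * t ^ (k : ℕ)

/-- `C` is the image of the complex projective line under the morphism
`[s : t] ↦ [f₀ : f₁ : f₂ : f₃]`, where the `fᵢ` are four linearly independent real
binary forms of degree `d` (the rows of `B`) without a common zero over `ℂ`. -/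
def IsParamCurve (d : ℕ) (C : Set Space) : Prop :=
  ∃ B : Matrix (Fin 4) (Fin (d + 1)) ℝ,
    LinearIndependent ℝ B.row ∧
    (∀ s t : ℂ, (s ≠ 0 ∨ t ≠ 0) → B.toComplex *ᵥ monomialVec d s t ≠ 0) ∧
    C = {x | ∃ (s t : ℂ) (h : B.toComplex *ᵥ monomialVec d s t ≠ 0),
      (s ≠ 0 ∨ t ≠ 0) ∧ x = Projectivization.mk ℂ _ h}

/-- A (real) twisted cubic: the image of `[s^3 : s^2 t : s t^2 : t^3]` under a real projective
transformation of 3-space. -/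
def IsTwistedCubic (C : Set Space) : Prop := IsParamCurve 3 C

/-- A (real) rational quartic space curve. As the four quartic forms are linearly independent, the
curve spans 3-space, so it has degree at least 3; hence the parametrization is birational onto
the curve, and the curve has degree exactly 4. -/
def IsRationalQuartic (C : Set Space) : Prop := IsParamCurve 4 C

/-- A line in projective 3-space, given by a 2-dimensional subspace, as a set of points. -/
def IsLine (L : Set Space) : Prop :=
  ∃ W : Submodule ℂ (Fin 4 → ℂ), Module.finrank ℂ W = 2 ∧ L = {x | x.submodule ≤ W}

end

/-!
In real coordinates in which the cubic is `[s³ : s²t : st² : t³]`, let `Mᵢ` be the cameras and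
`bᵢ` their centers. The quartic forms annihilated by a suitable functional `φ ≠ 0` define a rational
quartic, and the centers determine linear forms `lᵢ` such that the product of `lᵢ` with a cubic form
that vanishes at `bᵢ` is annihilated by `φ`. The products of `lᵢ` with the three forms that define
`Mᵢ` are therefore linear combinations of the coordinates of the quartic, which define a camera
`Tᵢ`. So the `Tᵢ` see the quartic as the `Mᵢ` see the cubic, and the center of `Tᵢ` is the point of
the quartic with parameter the zero of `lᵢ`. No point off the quartic is seen in this way: otherwise
three points of the cubic would lie on one ray of some `Mᵢ`.

Conversely, triangulation with the cameras `Tᵢ` of a conjugate has a polynomial solution `Y` along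
the cubic, so that `Tᵢ Y = cᵢ Mᵢ (1, X, X², X³)` for polynomials `cᵢ ≠ 0`. The multiplier `cᵢ` sends
the three-dimensional space of cubics through `bᵢ` into the span of the four coordinates of `Y`.
These three spaces share a pencil without base points, because the line of centers misses the cubic.
Comparing dimensions, the `cᵢ` are either proportional, and the configurations are equivalent, or
a common factor times pairwise independent linear forms, and `Y` is that factor times a quartic.
-/

section Multipliers

open Polynomial

variable {F : Type*} [Field F]

/-- Two polynomials, regarded as binary forms of degree `d`, without a common zero on the projective
line over the algebraic closure; the last condition excludes a common zero at infinity. -/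
structure CoprimeForms (d : ℕ) (n m : F[X]) : Prop where
  isCoprime : IsCoprime n m
  natDegree_left_le : n.natDegree ≤ d
  natDegree_right_le : m.natDegree ≤ d
  coeff_ne_zero : n.coeff d ≠ 0 ∨ m.coeff d ≠ 0

theorem degree_lt_of_degree_mul_lt {n q : F[X]} {d e : ℕ} (hn : n.coeff d ≠ 0)
    (h : (n * q).degree < (d + e : ℕ)) : q.degree < e := by
  have hdn : (d : WithBot ℕ) ≤ n.degree := le_degree_of_ne_zero hn
  by_contra! hq
  refine h.not_ge ?_
  rw [degree_mul, Nat.cast_add]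
  exact add_le_add hdn hq

theorem degree_mul_lt_add {n f : F[X]} {d e : ℕ} (hn : n.natDegree ≤ d) (hf : f.degree < e) :
    (n * f).degree < (d + e : ℕ) := by
  rcases eq_or_ne (n * f) 0 with h0 | h0
  · simp [h0]
  · rw [← natDegree_lt_iff_degree_lt h0]
    rw [← natDegree_lt_iff_degree_lt (right_ne_zero_of_mul h0)] at hf
    exact natDegree_mul_le.trans_lt (by lia)

theorem degree_add_lt {f g : F[X]} {d : ℕ} (hf : f.degree < d) (hg : g.degree < d) :
    (f + g).degree < d :=
  (degree_add_le f g).trans_lt (max_lt hf hg)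

theorem degree_C_mul_lt {f : F[X]} {d : ℕ} (hf : f.degree < d) (x : F) : (C x * f).degree < d := by
  simpa only [zero_add] using degree_mul_lt_add (d := 0) (natDegree_C x).le hf

namespace CoprimeForms

variable {d : ℕ} {n m : F[X]}

theorem exists_quotient (h : CoprimeForms d n m) {e : ℕ} {f g : F[X]} (hf : f.degree < (d + e : ℕ))
    (hg : g.degree < (d + e : ℕ)) (hfg : n * f = m * g) :
    ∃ q : F[X], q.degree < e ∧ f = m * q ∧ g = n * q := by
  obtain ⟨a, b, hab⟩ := h.isCoprime
  have hfq : f = m * (a * g + b * f) := by linear_combination (-f) * hab + a * hfg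
  have hgq : g = n * (a * g + b * f) := by linear_combination (-g) * hab - b * hfg
  refine ⟨a * g + b * f, ?_, hfq, hgq⟩
  rcases h.coeff_ne_zero with hn | hm
  · exact degree_lt_of_degree_mul_lt hn (hgq ▸ hg)
  · exact degree_lt_of_degree_mul_lt hm (hfq ▸ hf)

theorem exists_eq_mul_C (h : CoprimeForms d n m) {f g : F[X]} (hf : f.degree < (d + 1 : ℕ))
    (hg : g.degree < (d + 1 : ℕ)) (hfg : n * f = m * g) :
    ∃ z : F, f = m * C z ∧ g = n * C z := by
  obtain ⟨q, hq, hfq, hgq⟩ := h.exists_quotient hf hg hfg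
  have hq0 : q = C (q.coeff 0) :=
    eq_C_of_natDegree_le_zero (natDegree_le_of_degree_le (Order.le_of_lt_succ hq))
  exact ⟨q.coeff 0, hq0 ▸ hfq, hq0 ▸ hgq⟩

theorem eq_zero_of_mul_eq_mul (h : CoprimeForms d n m) {f g : F[X]} (hf : f.degree < d)
    (hg : g.degree < d) (hfg : n * f = m * g) : f = 0 ∧ g = 0 := by
  obtain ⟨q, hq, rfl, rfl⟩ := h.exists_quotient (e := 0) hf hg hfg
  simp_all

section LowDegree

variable {w u : F[X]}

theorem eq_zero_of_mul_linear_eq (h : CoprimeForms d n m) (hw : w.degree < d) (hu : u.degree < d)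
    (hwu : LinearIndependent F ![w, u]) {x y x' y' : F}
    (heq : w * (C x * n + C y * m) = u * (C x' * n + C y' * m)) :
    (x = 0 ∧ y = 0) ∧ x' = 0 ∧ y' = 0 := by
  have hdeg (a b : F) : (C a * w + C b * u).degree < d :=
    degree_add_lt (degree_C_mul_lt hw a) (degree_C_mul_lt hu b)
  obtain ⟨hn, hm⟩ := h.eq_zero_of_mul_eq_mul (hdeg x (-x')) (hdeg (-y) y') (by
    simp only [C_neg]; linear_combination heq)
  simp only [← smul_eq_C_mul] at hn hm
  have := LinearIndependent.pair_iff.mp hwu _ _ hn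
  have := LinearIndependent.pair_iff.mp hwu _ _ hm
  simp_all

theorem eq_zero_of_mul_quadratic_eq (h : CoprimeForms d n m) (hw : w.degree < d) (hu : u.degree < d)
    (hwu : LinearIndependent F ![w, u]) {x y z x' y' z' : F}
    (heq : w * (C x * n ^ 2 + C y * (n * m) + C z * m ^ 2) =
      u * (C x' * n ^ 2 + C y' * (n * m) + C z' * m ^ 2)) :
    (x = 0 ∧ y = 0 ∧ z = 0) ∧ x' = 0 ∧ y' = 0 ∧ z' = 0 := by
  have hpencil (a b : F) : (C a * n + C b * m).natDegree ≤ d :=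
    natDegree_add_le_of_degree_le ((natDegree_C_mul_le a n).trans h.natDegree_left_le)
      ((natDegree_C_mul_le b m).trans h.natDegree_right_le)
  have hwlin := degree_mul_lt_add (hpencil x y) hw
  have hulin := degree_mul_lt_add (hpencil (-x') (-y')) hu
  have hcomb := degree_add_lt (degree_C_mul_lt hu z') (degree_C_mul_lt hw (-z))
  obtain ⟨q, hq, hlin, hmq⟩ := h.exists_quotient (degree_add_lt hwlin hulin)
    (degree_mul_lt_add h.natDegree_right_le hcomb)
    (by simp only [C_neg]; linear_combination heq)
  obtain ⟨rfl, hzero⟩ := h.eq_zero_of_mul_eq_mul hq hcomb hmq.symm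
  have hz := LinearIndependent.pair_iff.mp hwu (-z) z' (by
    simp only [smul_eq_C_mul]; linear_combination hzero)
  have hxy := h.eq_zero_of_mul_linear_eq (x := x) (y := y) (x' := x') (y' := y') hw hu hwu (by
    simp only [C_neg] at hlin; linear_combination hlin)
  simp_all

end LowDegree

end CoprimeForms

theorem finrank_map_mulLeft {c : F[X]} (hc : c ≠ 0) (S : Submodule F F[X]) :
    Module.finrank F (S.map (LinearMap.mulLeft F c)) = Module.finrank F S :=
  (S.equivMapOfInjective _ (mul_right_injective₀ hc)).finrank_eq.symm

theorem finrank_degreeLT (d : ℕ) : Module.finrank F (degreeLT F d) = d := by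
  rw [(degreeLTEquiv F d).finrank_eq, Module.finrank_fin_fun]

theorem finrank_add_finrank_le_of_isCoprime {S T : Submodule F F[X]} {d : ℕ}
    (hS : S ≤ degreeLT F d) (hT : T ≤ degreeLT F d) {q w u : F[X]} (hw : q * w ≠ 0)
    (hu : q * u ≠ 0) (hwu : IsCoprime w u) :
    Module.finrank F S + Module.finrank F T ≤
      Module.finrank F (S.map (LinearMap.mulLeft F (q * w)) ⊔ T.map (LinearMap.mulLeft F (q * u)) :
        Submodule F F[X]) + (d - u.natDegree) := by
  have := Submodule.finiteDimensional_of_le hS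
  have := Submodule.finiteDimensional_of_le hT
  have hinf : S.map (LinearMap.mulLeft F (q * w)) ⊓ T.map (LinearMap.mulLeft F (q * u)) ≤
      (degreeLT F (d - u.natDegree)).map (LinearMap.mulLeft F (q * w * u)) := by
    rintro _ ⟨⟨f, hf, rfl⟩, g, -, hfg⟩
    simp only [LinearMap.mulLeft_apply] at hfg
    obtain ⟨v, rfl⟩ : u ∣ f := hwu.symm.dvd_of_dvd_mul_left ⟨g, by
      apply mul_left_cancel₀ (left_ne_zero_of_mul hw); linear_combination -hfg⟩
    refine ⟨v, ?_, by simp only [LinearMap.mulLeft_apply, mul_assoc]⟩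
    have huv := mem_degreeLT.mp (hS hf)
    rcases eq_or_ne v 0 with rfl | hv
    · exact zero_mem _
    · have hu' := right_ne_zero_of_mul hu
      rw [SetLike.mem_coe, mem_degreeLT, ← natDegree_lt_iff_degree_lt hv]
      rw [← natDegree_lt_iff_degree_lt (mul_ne_zero hu' hv), natDegree_mul hu' hv] at huv
      lia
  rw [← finrank_map_mulLeft hw S, ← finrank_map_mulLeft hu T,
    ← Submodule.finrank_sup_add_finrank_inf_eq]
  grw [Submodule.finrank_mono hinf,
    finrank_map_mulLeft (mul_ne_zero hw (right_ne_zero_of_mul hu)), finrank_degreeLT]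

end Multipliers

section NetTriple

open Polynomial

variable {F : Type*} [Field F]

/-- Three nets of binary cubic forms (in dehomogenised form) through a common pencil without base
points, which is spanned by `n` and `m`. Such nets arise from three collinear points outside a
twisted cubic: the planes through the `i`-th point cut the cubic in the forms of `N i`, those
through the line in the forms of the pencil. -/
structure NetTriple (N : Fin 3 → Submodule F F[X]) (n m : F[X]) : Prop where
  coprime : CoprimeForms 3 n m
  left_mem : ∀ i, n ∈ N i
  right_mem : ∀ i, m ∈ N i
  finrank_eq : ∀ i, Module.finrank F (N i) = 3
  sup_eq : ∀ i j, i ≠ j → N i ⊔ N j = degreeLT F 4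

/-- Nonzero multipliers `c i` that send the nets `N i` into a common space `V` of dimension at most
four. -/
structure IsMultiplierTriple (N : Fin 3 → Submodule F F[X]) (V : Submodule F F[X])
    (c : Fin 3 → F[X]) : Prop where
  ne_zero : ∀ i, c i ≠ 0
  mul_mem : ∀ i, ∀ f ∈ N i, c i * f ∈ V
  finiteDimensional : FiniteDimensional F V
  finrank_le : Module.finrank F V ≤ 4

theorem exists_eq_mul_isCoprime {f g : F[X]} (hg : g ≠ 0) :
    ∃ q w u : F[X], IsCoprime w u ∧ f = q * w ∧ g = q * u := by
  classical
  let _ := EuclideanDomain.gcdMonoid F[X]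
  exact ⟨gcd f g, f / gcd f g, g / gcd f g, isCoprime_div_gcd_div_gcd hg,
    (EuclideanDomain.mul_div_cancel' (gcd_ne_zero_of_right hg) (gcd_dvd_left f g)).symm,
    (EuclideanDomain.mul_div_cancel' (gcd_ne_zero_of_right hg) (gcd_dvd_right f g)).symm⟩

theorem linearIndependent_mul_left {q w u : F[X]} (hq : q ≠ 0) :
    LinearIndependent F ![q * w, q * u] ↔ LinearIndependent F ![w, u] := by
  have hcomp : ![q * w, q * u] = LinearMap.mulLeft F q ∘ ![w, u] := by
    funext i; fin_cases i <;> rfl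
  rw [hcomp]
  exact LinearMap.linearIndependent_iff_of_injOn _ (mul_right_injective₀ hq).injOn

variable {N : Fin 3 → Submodule F F[X]} {V : Submodule F F[X]} {n m : F[X]} {c : Fin 3 → F[X]}

theorem IsMultiplierTriple.map_mulLeft_le (hc : IsMultiplierTriple N V c) (i : Fin 3) :
    (N i).map (LinearMap.mulLeft F (c i)) ≤ V := by
  rintro _ ⟨f, hf, rfl⟩
  exact hc.mul_mem i f hf

namespace NetTriple

theorem le_degreeLT (h : NetTriple N n m) (i : Fin 3) : N i ≤ degreeLT F 4 := by
  rw [← h.sup_eq i (i + 1) (by decide +revert)]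
  exact le_sup_left

theorem eq_smul_of_eq_smul (h : NetTriple N n m) (hc : IsMultiplierTriple N V c) {j k : Fin 3}
    (hjk : j ≠ k) {x : F} (hx : c k = x • c j) (i : Fin 3) : ∃ z : F, c i = z • c j := by
  have hx0 : x ≠ 0 := by rintro rfl; exact hc.ne_zero k (by simpa using hx)
  have := hc.finiteDimensional
  have hsup : (degreeLT F 4).map (LinearMap.mulLeft F (c j)) ≤ V := by
    rw [← h.sup_eq j k hjk, Submodule.map_sup]
    refine sup_le (hc.map_mulLeft_le j) ?_
    rintro _ ⟨f, hf, rfl⟩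
    have hkf := V.smul_mem x⁻¹ (hc.mul_mem k f hf)
    rwa [hx, smul_mul_assoc, inv_smul_smul₀ hx0] at hkf
  have hV : (degreeLT F 4).map (LinearMap.mulLeft F (c j)) = V :=
    Submodule.eq_of_le_of_finrank_le hsup (by
      rw [finrank_map_mulLeft (hc.ne_zero j), finrank_degreeLT]; exact hc.finrank_le)
  obtain ⟨r, hr, hrn⟩ := hV.ge (hc.mul_mem i n (h.left_mem i))
  obtain ⟨r', hr', hrm⟩ := hV.ge (hc.mul_mem i m (h.right_mem i))
  rw [LinearMap.mulLeft_apply] at hrn hrm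
  obtain ⟨z, rfl, rfl⟩ := h.coprime.exists_eq_mul_C (mem_degreeLT.mp hr') (mem_degreeLT.mp hr)
    (mul_left_cancel₀ (hc.ne_zero j) (by linear_combination n * hrm - m * hrn))
  obtain ⟨a, b, hab⟩ := h.coprime.isCoprime
  refine ⟨z, ?_⟩
  rw [smul_eq_C_mul]
  linear_combination (C z * c j - c i) * hab - a * hrn - b * hrm

theorem eq_smul_or_linearIndependent (h : NetTriple N n m) (hc : IsMultiplierTriple N V c) :
    (∃ z : Fin 3 → F, ∀ i, c i = z i • c 0) ∨
      ∀ i j, i ≠ j → LinearIndependent F ![c i, c j] := by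
  by_contra! ⟨hprop, i, j, hij, hdep⟩
  rw [LinearIndependent.pair_iff' (hc.ne_zero i)] at hdep
  push Not at hdep
  obtain ⟨x, hx⟩ := hdep
  choose z hz using h.eq_smul_of_eq_smul hc hij hx.symm
  have hz0 : z 0 ≠ 0 := fun h0 ↦ hc.ne_zero 0 (by rw [hz, h0, zero_smul])
  obtain ⟨k, hk⟩ := hprop fun k ↦ z k / z 0
  exact hk (by rw [hz k, hz 0, smul_smul, div_mul_cancel₀ _ hz0])

section Independent

variable {q w u : F[X]}

theorem natDegree_le_two (h : NetTriple N n m) (hc : IsMultiplierTriple N V c) {i j : Fin 3}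
    (hi : c i = q * w) (hj : c j = q * u) (hwu : IsCoprime w u) : u.natDegree ≤ 2 := by
  have := hc.finiteDimensional
  have hdim := finrank_add_finrank_le_of_isCoprime (h.le_degreeLT i) (h.le_degreeLT j)
    (hi ▸ hc.ne_zero i) (hj ▸ hc.ne_zero j) hwu
  rw [← hi, ← hj, h.finrank_eq, h.finrank_eq] at hdim
  have hV := Submodule.finrank_mono (sup_le (hc.map_mulLeft_le i) (hc.map_mulLeft_le j))
  have := hc.finrank_le
  lia

theorem span_mul_pencil_eq (h : NetTriple N n m) (hc : IsMultiplierTriple N V c)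
    (hq : q ≠ 0) (h0 : c 0 = q * w) (h1 : c 1 = q * u) (hw : w.degree < (3 : ℕ))
    (hu : u.degree < (3 : ℕ)) (hwu : LinearIndependent F ![w, u]) :
    Module.finrank F V = 4 ∧ ∀ f ∈ V, ∃ x y x' y' : F,
      f = c 0 * (C x * n + C y * m) + c 1 * (C x' * n + C y' * m) := by
  have := hc.finiteDimensional
  have hmem : ∀ k, ![c 0 * n, c 0 * m, c 1 * n, c 1 * m] k ∈ V := by
    intro k
    fin_cases k
    exacts [hc.mul_mem 0 n (h.left_mem 0), hc.mul_mem 0 m (h.right_mem 0),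
      hc.mul_mem 1 n (h.left_mem 1), hc.mul_mem 1 m (h.right_mem 1)]
  have hind : LinearIndependent F ![c 0 * n, c 0 * m, c 1 * n, c 1 * m] := by
    rw [Fintype.linearIndependent_iff]
    intro g hg
    simp only [Fin.sum_univ_four, Matrix.cons_val, smul_eq_C_mul] at hg
    obtain ⟨⟨e0, e1⟩, e2, e3⟩ := h.coprime.eq_zero_of_mul_linear_eq (x := g 0) (y := g 1)
      (x' := -g 2) (y' := -g 3) hw hu hwu (mul_left_cancel₀ hq (by
        rw [h0, h1] at hg; simp only [C_neg]; linear_combination hg))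
    intro k
    fin_cases k
    exacts [e0, e1, neg_eq_zero.mp e2, neg_eq_zero.mp e3]
  have hspan : Submodule.span F (Set.range ![c 0 * n, c 0 * m, c 1 * n, c 1 * m]) = V :=
    Submodule.eq_of_le_of_finrank_le (Submodule.span_le.mpr (Set.range_subset_iff.mpr hmem))
      (by rw [finrank_span_eq_card hind, Fintype.card_fin]; exact hc.finrank_le)
  refine ⟨by rw [← hspan, finrank_span_eq_card hind, Fintype.card_fin], fun f hf ↦ ?_⟩
  obtain ⟨g, rfl⟩ := (Submodule.mem_span_range_iff_exists_fun F).mp (hspan.ge hf)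
  refine ⟨g 0, g 1, g 2, g 3, ?_⟩
  simp only [Fin.sum_univ_four, Matrix.cons_val, smul_eq_C_mul]
  ring

theorem exists_eq_add (h : NetTriple N n m) (hc : IsMultiplierTriple N V c)
    (hq : q ≠ 0) (h0 : c 0 = q * w) (h1 : c 1 = q * u) (hw : w.degree < (3 : ℕ))
    (hu : u.degree < (3 : ℕ)) (hwu : LinearIndependent F ![w, u]) :
    ∃ x y : F, c 2 = C x * c 0 + C y * c 1 := by
  have hspan := (h.span_mul_pencil_eq hc hq h0 h1 hw hu hwu).2
  obtain ⟨x, y, x', y', hn⟩ := hspan _ (hc.mul_mem 2 n (h.left_mem 2))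
  obtain ⟨z, v, z', v', hm⟩ := hspan _ (hc.mul_mem 2 m (h.right_mem 2))
  -- Comparing the two expressions for `c 2 * n * m`.
  have hquad := h.coprime.eq_zero_of_mul_quadratic_eq (x := z) (y := v - x) (z := -y) (x' := -z')
    (y' := x' - v') (z' := y') hw hu hwu (mul_left_cancel₀ hq (by
      rw [h0, h1] at hn hm
      simp only [C_neg, C_sub]
      linear_combination m * hn - n * hm))
  obtain ⟨⟨rfl, hvx, hy⟩, hz', hxv', rfl⟩ := hquad
  obtain rfl := sub_eq_zero.mp hvx
  obtain rfl := sub_eq_zero.mp hxv'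
  rw [neg_eq_zero.mp hy, C_0] at hn
  rw [neg_eq_zero.mp hz', C_0] at hm
  obtain ⟨a, b, hab⟩ := h.coprime.isCoprime
  refine ⟨v, x', ?_⟩
  linear_combination (C v * c 0 + C x' * c 1 - c 2) * hab + a * hn + b * hm

theorem finrank_sup_map_mulLeft_le (h : NetTriple N n m) (hc : IsMultiplierTriple N V c)
    (i : Fin 3) :
    Module.finrank F (V ⊔ (degreeLT F 4).map (LinearMap.mulLeft F (c i)) : Submodule F F[X]) ≤
      5 := by
  have := hc.finiteDimensional
  have hinf := Submodule.finrank_mono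
    (le_inf (hc.map_mulLeft_le i) (Submodule.map_mono (h.le_degreeLT i)))
  have hsum := Submodule.finrank_sup_add_finrank_inf_eq V
    ((degreeLT F 4).map (LinearMap.mulLeft F (c i)))
  rw [finrank_map_mulLeft (hc.ne_zero i), h.finrank_eq] at hinf
  rw [finrank_map_mulLeft (hc.ne_zero i), finrank_degreeLT] at hsum
  have := hc.finrank_le
  lia

theorem map_mulLeft_le_sup (h : NetTriple N n m) (hc : IsMultiplierTriple N V c) {x y : F}
    (hy : y ≠ 0) (h2 : c 2 = C x * c 0 + C y * c 1) :
    (degreeLT F 4).map (LinearMap.mulLeft F (c 1)) ≤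
      V ⊔ (degreeLT F 4).map (LinearMap.mulLeft F (c 0)) := by
  rw [← h.sup_eq 1 2 (by decide), Submodule.map_sup]
  refine sup_le ((hc.map_mulLeft_le 1).trans le_sup_left) ?_
  rw [h.sup_eq 1 2 (by decide)]
  rintro _ ⟨f, hf, rfl⟩
  have hf2 : c 2 * f ∈ V := hc.mul_mem 2 f hf
  have hf0 : c 0 * f ∈ (degreeLT F 4).map (LinearMap.mulLeft F (c 0)) :=
    ⟨f, h.le_degreeLT 2 hf, rfl⟩
  refine Submodule.mem_sup.mpr ⟨y⁻¹ • (c 2 * f), V.smul_mem _ hf2, (-(y⁻¹ * x)) • (c 0 * f),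
    Submodule.smul_mem _ _ hf0, ?_⟩
  have hyC : C y⁻¹ * C y = 1 := by rw [← C_mul, inv_mul_cancel₀ hy, C_1]
  simp only [LinearMap.mulLeft_apply, smul_eq_C_mul, C_neg, C_mul]
  linear_combination C y⁻¹ * f * h2 + c 1 * f * hyC

theorem natDegree_le_one_of_eq_add (h : NetTriple N n m) (hc : IsMultiplierTriple N V c)
    (h0 : c 0 = q * w) (h1 : c 1 = q * u) (hwu : IsCoprime w u) {x y : F} (hy : y ≠ 0)
    (h2 : c 2 = C x * c 0 + C y * c 1) : w.natDegree ≤ 1 ∧ u.natDegree ≤ 1 := by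
  have := hc.finiteDimensional
  have hsup := Submodule.finrank_mono (sup_le le_sup_right (h.map_mulLeft_le_sup hc hy h2))
  have hV := hsup.trans (h.finrank_sup_map_mulLeft_le hc 0)
  have hw0 := h0 ▸ hc.ne_zero 0
  have hu0 := h1 ▸ hc.ne_zero 1
  have hu := finrank_add_finrank_le_of_isCoprime le_rfl le_rfl hw0 hu0 hwu (d := 4)
  have hw := finrank_add_finrank_le_of_isCoprime le_rfl le_rfl hu0 hw0 hwu.symm (d := 4)
  rw [finrank_degreeLT, ← h0, ← h1] at hu hw
  rw [sup_comm] at hw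
  lia

end Independent

theorem eq_smul_or_exists_linear_factorization (h : NetTriple N n m)
    (hc : IsMultiplierTriple N V c) :
    (∃ z : Fin 3 → F, ∀ i, c i = z i • c 0) ∨
      Module.finrank F V = 4 ∧ ∃ (q : F[X]) (w : Fin 3 → F[X]), q ≠ 0 ∧
        (∀ i, (w i).natDegree ≤ 1 ∧ c i = q * w i) ∧
        ∀ i j, i ≠ j → LinearIndependent F ![w i, w j] := by
  refine (h.eq_smul_or_linearIndependent hc).imp_right fun hind ↦ ?_
  obtain ⟨q, w, u, hwu, h0, h1⟩ := exists_eq_mul_isCoprime (f := c 0) (hc.ne_zero 1)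
  have hq : q ≠ 0 := left_ne_zero_of_mul (h0 ▸ hc.ne_zero 0)
  have hli : LinearIndependent F ![w, u] :=
    (linearIndependent_mul_left hq).mp (h0 ▸ h1 ▸ hind 0 1 (by decide))
  have hdeg {v : F[X]} (hv : v.natDegree ≤ 2) : v.degree < (3 : ℕ) :=
    degree_le_natDegree.trans_lt (by exact_mod_cast Nat.lt_succ_of_le hv)
  have hw := hdeg (h.natDegree_le_two hc h1 h0 hwu.symm)
  have hu := hdeg (h.natDegree_le_two hc h0 h1 hwu)
  refine ⟨(h.span_mul_pencil_eq hc hq h0 h1 hw hu hli).1, q, ?_⟩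
  obtain ⟨x, y, h2⟩ := h.exists_eq_add hc hq h0 h1 hw hu hli
  have hy : y ≠ 0 := by
    rintro rfl
    refine (LinearIndependent.pair_iff' (hc.ne_zero 0)).mp (hind 0 2 (by decide)) x ?_
    rw [h2, C_0, zero_mul, add_zero, smul_eq_C_mul]
  have hle := h.natDegree_le_one_of_eq_add hc h0 h1 hwu hy h2
  have hfac : ∀ i, c i = q * ![w, u, C x * w + C y * u] i := by
    intro i
    fin_cases i
    exacts [h0, h1, h2.trans (by rw [h0, h1]; simp only [Fin.reduceFinMk, Matrix.cons_val]; ring)]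
  refine ⟨![w, u, C x * w + C y * u], hq, fun i ↦ ⟨?_, hfac i⟩, fun i j hij ↦ ?_⟩
  · fin_cases i
    exacts [hle.1, hle.2, natDegree_add_le_of_degree_le ((natDegree_C_mul_le x w).trans hle.1)
      ((natDegree_C_mul_le y u).trans hle.2)]
  · rw [← linearIndependent_mul_left hq, ← hfac, ← hfac]
    exact hind i j hij

end NetTriple

end NetTriple

/-- The moment vector `(s ^ d, s ^ (d - 1) * t, …, t ^ d)`: over `ℂ` this is `monomialVec`, and over
`ℝ[X]` it parametrizes the affine part of a rational curve. -/
def momentVec {R : Type*} [CommSemiring R] (d : ℕ) (s t : R) : Fin (d + 1) → R :=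
  fun k ↦ s ^ (d - (k : ℕ)) * t ^ (k : ℕ)

/-- A real vector regarded as a complex vector. -/
noncomputable abbrev complexVec {n : Type*} (v : n → ℝ) : n → ℂ := algebraMap ℝ ℂ ∘ v

/-- The value at `(s, t)` of the binary linear form with coefficients `l`. -/
noncomputable def linForm {R : Type*} [CommSemiring R] [Algebra ℝ R] (l : Fin 2 → ℝ)
    (s t : R) : R :=
  algebraMap ℝ R (l 0) * s + algebraMap ℝ R (l 1) * t

/-- The matrix of the product of a binary cubic form with the linear form with coefficients `l`:
row `k` holds the coefficients of the product of `l` with the `k`-th cubic monomial. -/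
noncomputable def shiftMatrix (l : Fin 2 → ℝ) : Matrix (Fin 4) (Fin 5) ℝ :=
  !![l 0, l 1, 0, 0, 0; 0, l 0, l 1, 0, 0; 0, 0, l 0, l 1, 0; 0, 0, 0, l 0, l 1]

/-- The rational curve parametrized by the binary forms of degree `d` in the rows of `B`. -/
def paramCurve (d : ℕ) (B : Matrix (Fin 4) (Fin (d + 1)) ℝ) : Set Space :=
  {x | ∃ (s t : ℂ) (h : B.toComplex *ᵥ momentVec d s t ≠ 0),
    (s ≠ 0 ∨ t ≠ 0) ∧ x = Projectivization.mk ℂ _ h}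

section MatrixVector

variable {l m n R : Type*} [Fintype m] [Fintype n] [CommSemiring R] [Algebra ℝ R]

theorem map_mulVec_map_mulVec (A : Matrix l m ℝ) (B : Matrix m n ℝ) (v : n → R) :
    A.map (algebraMap ℝ R) *ᵥ (B.map (algebraMap ℝ R) *ᵥ v) =
      (A * B).map (algebraMap ℝ R) *ᵥ v := by
  rw [Matrix.map_mul, Matrix.mulVec_mulVec]

theorem complexVec_mulVec (A : Matrix l m ℝ) (v : m → ℝ) :
    A.toComplex *ᵥ complexVec v = complexVec (A *ᵥ v) := by
  ext i
  exact (RingHom.map_mulVec (algebraMap ℝ ℂ) A v i).symm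

end MatrixVector

theorem complexVec_eq_zero {n : Type*} {v : n → ℝ} : complexVec v = 0 ↔ v = 0 := by
  simp [funext_iff]

theorem linearIndependent_complexVec_pair {n : Type*} [Finite n] {v w : n → ℝ} :
    LinearIndependent ℂ ![complexVec v, complexVec w] ↔ LinearIndependent ℝ ![v, w] := by
  have hcomp : ![complexVec v, complexVec w] = fun i ↦ algebraMap ℝ ℂ ∘ ![v, w] i := by
    funext i; fin_cases i <;> rfl
  rw [hcomp, linearIndependent_algebraMap_comp_iff]

theorem mem_span_pair_of_complexVec_mem {n : Type*} {u v w : n → ℝ}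
    (h : complexVec u ∈ Submodule.span ℂ {complexVec v, complexVec w}) :
    u ∈ Submodule.span ℝ {v, w} := by
  obtain ⟨x, y, hxy⟩ := Submodule.mem_span_pair.mp h
  refine Submodule.mem_span_pair.mpr ⟨x.re, y.re, ?_⟩
  ext k
  simpa using congrArg Complex.re (congrFun hxy k)

theorem toComplex_mulVec_injective {n : Type*} [Fintype n] [DecidableEq n] (A : GL n ℝ) :
    Function.Injective (A.val.toComplex *ᵥ ·) := by
  refine Function.LeftInverse.injective (g := ((A⁻¹).val.toComplex *ᵥ ·)) fun v ↦ ?_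
  dsimp only
  rw [map_mulVec_map_mulVec, ← Units.val_mul, inv_mul_cancel, Units.val_one,
    Matrix.map_one _ (map_zero _) (map_one _), Matrix.one_mulVec]

theorem shiftMatrix_mulVec_apply {R : Type*} [CommSemiring R] [Algebra ℝ R] (l : Fin 2 → ℝ)
    (v : Fin 5 → R) (k : Fin 4) :
    ((shiftMatrix l).map (algebraMap ℝ R) *ᵥ v) k = linForm l (v k.castSucc) (v k.succ) := by
  fin_cases k <;> simp [shiftMatrix, linForm, Matrix.mulVec, dotProduct, Fin.sum_univ_five]

theorem shiftMatrix_mulVec_momentVec {R : Type*} [CommSemiring R] [Algebra ℝ R] (l : Fin 2 → ℝ)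
    (s t : R) : (shiftMatrix l).map (algebraMap ℝ R) *ᵥ momentVec 4 s t =
      linForm l s t • momentVec 3 s t := by
  ext k
  rw [shiftMatrix_mulVec_apply]
  fin_cases k <;> simp [momentVec, linForm] <;> ring

theorem eq_zero_of_momentVec_combination {s₁ t₁ s₂ t₂ s₃ t₃ x y z : ℂ}
    (h₁₃ : s₃ * t₁ - t₃ * s₁ ≠ 0) (h₂₃ : s₃ * t₂ - t₃ * s₂ ≠ 0)
    (h : x • momentVec 3 s₁ t₁ + y • momentVec 3 s₂ t₂ + z • momentVec 3 s₃ t₃ = 0) : z = 0 := by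
  have e₀ := congrFun h 0
  have e₁ := congrFun h 1
  have e₂ := congrFun h 2
  have e₃ := congrFun h 3
  simp only [Nat.reduceAdd, Fin.isValue, Pi.add_apply, Pi.smul_apply, momentVec,
    Fin.coe_ofNat_eq_mod, Nat.zero_mod, tsub_zero, pow_zero, mul_one, smul_eq_mul, Pi.zero_apply,
    Nat.one_mod, Nat.add_one_sub_one, pow_one, Nat.reduceMod, Nat.reduceSub, Nat.mod_succ,
    tsub_self, one_mul] at e₀ e₁ e₂ e₃
  have hd := mul_ne_zero h₁₃ h₂₃
  -- Apply to `h` the quadratic form with roots `(s₁, t₁)` and `(s₂, t₂)`, times `s` and times `t`.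
  have hs : z * s₃ * ((s₃ * t₁ - t₃ * s₁) * (s₃ * t₂ - t₃ * s₂)) = 0 := by
    linear_combination t₁ * t₂ * e₀ - (t₁ * s₂ + s₁ * t₂) * e₁ + s₁ * s₂ * e₂
  have ht : z * t₃ * ((s₃ * t₁ - t₃ * s₁) * (s₃ * t₂ - t₃ * s₂)) = 0 := by
    linear_combination t₁ * t₂ * e₁ - (t₁ * s₂ + s₁ * t₂) * e₂ + s₁ * s₂ * e₃
  by_contra hz
  have hs₃ := (mul_eq_zero.mp ((mul_eq_zero.mp hs).resolve_right hd)).resolve_left hz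
  have ht₃ := (mul_eq_zero.mp ((mul_eq_zero.mp ht).resolve_right hd)).resolve_left hz
  simp [hs₃, ht₃] at h₁₃

theorem projectivization_mk_eq_of_eq_smul {n : Type*} {v w : n → ℂ} (hv : v ≠ 0) (hw : w ≠ 0)
    {c : ℂ} (h : v = c • w) : Projectivization.mk ℂ v hv = Projectivization.mk ℂ w hw :=
  (Projectivization.mk_eq_mk_iff' ℂ v w hv hw).mpr ⟨c, h.symm⟩

namespace Camera

variable (P : Camera)

theorem exists_right_inv : ∃ G : Matrix (Fin 4) (Fin 3) ℝ, P.mat * G = 1 := by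
  have hrange : LinearMap.range P.mat.mulVecLin = ⊤ :=
    Submodule.eq_top_of_finrank_eq (by rw [Module.finrank_fin_fun]; exact P.full_rank)
  exact Matrix.mulVec_surjective_iff_exists_right_inverse.mp (LinearMap.range_eq_top.mp hrange)

theorem exists_mulVec_eq_zero : ∃ b : Fin 4 → ℝ, b ≠ 0 ∧ P.mat *ᵥ b = 0 := by
  have hker : LinearMap.ker P.mat.mulVecLin ≠ ⊥ :=
    LinearMap.ker_ne_bot_of_finrank_lt (by simp)
  obtain ⟨b, hb, hb0⟩ := Submodule.exists_mem_ne_zero_of_ne_bot hker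
  exact ⟨b, hb0, hb⟩

variable {P}

theorem exists_eq_smul {v w : Fin 4 → ℂ} (hv : v ≠ 0) (hPv : P.mat.toComplex *ᵥ v = 0)
    (hPw : P.mat.toComplex *ᵥ w = 0) : ∃ c : ℂ, w = c • v := by
  obtain ⟨c, hc⟩ := (finrank_eq_one_iff_of_nonzero'
    (⟨v, hPv⟩ : LinearMap.ker P.mat.toComplex.mulVecLin)
    fun h ↦ hv (congrArg Subtype.val h)).mp P.finrank_ker ⟨w, hPw⟩
  exact ⟨c, (congrArg Subtype.val hc).symm⟩

theorem center_eq_mk {v : Fin 4 → ℂ} (hv : v ≠ 0) (hPv : P.mat.toComplex *ᵥ v = 0) :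
    P.center = Projectivization.mk ℂ v hv := by
  apply Projectivization.submodule_injective
  rw [center, Projectivization.submodule_mk'', Projectivization.submodule_mk]
  refine (Submodule.eq_of_le_of_finrank_eq ?_ ?_).symm
  · exact (Submodule.span_singleton_le_iff_mem _ _).mpr hPv
  · rw [P.finrank_ker, finrank_span_singleton hv]

variable (P)

/-- The camera `P` in the coordinates given by the columns of `A`. -/
noncomputable def changeCoords (A : GL (Fin 4) ℝ) : Camera where
  mat := P.mat * A.val
  full_rank := by
    rw [Matrix.rank_mul_eq_left_of_isUnit_det _ _ (Matrix.isUnit_iff_isUnit_det _ |>.mp A.isUnit)]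
    exact P.full_rank

end Camera

/-- The cameras `Q` see `w` as the cameras `P` see `v`, up to scale, wherever `P` sees `v`. -/
def SeesAs {n : ℕ} (P Q : Fin n → Camera) (v w : Fin 4 → ℂ) : Prop :=
  ∀ i, ∃ c : ℂ, (Q i).mat.toComplex *ᵥ w = c • (P i).mat.toComplex *ᵥ v

namespace CameraTuple

variable {n : ℕ} {P Q : CameraTuple n} {X Y : Set Space}

theorem sees_mk {v : Fin 4 → ℂ} (hv : v ≠ 0) {z : Fin n → Image} :
    P.Sees (Projectivization.mk ℂ v hv) z ↔
      ∀ i, ∃ c : ℂ, (P.cam i).mat.toComplex *ᵥ v = c • (z i).rep := by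
  obtain ⟨a, ha⟩ := Projectivization.exists_smul_eq_mk_rep ℂ v hv
  refine forall_congr' fun i ↦ ?_
  rw [← ha, Units.smul_def, Matrix.mulVec_smul]
  constructor
  · rintro ⟨c, hc⟩
    exact ⟨(a : ℂ)⁻¹ * c, by rw [← smul_smul, ← hc, inv_smul_smul₀ a.ne_zero]⟩
  · rintro ⟨c, hc⟩
    exact ⟨a * c, by rw [hc, smul_smul]⟩

theorem exists_sees (P : CameraTuple n) (x : Space) : ∃ z, P.Sees x z := by
  suffices ∀ i, ∃ z : Image, ∃ c : ℂ, (P.cam i).mat.toComplex *ᵥ x.rep = c • z.rep from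
    Classical.skolem.mp this
  intro i
  by_cases h : (P.cam i).mat.toComplex *ᵥ x.rep = 0
  · exact ⟨Projectivization.mk ℂ 1 one_ne_zero, 0, by rw [h, zero_smul]⟩
  · obtain ⟨a, ha⟩ := Projectivization.exists_smul_eq_mk_rep ℂ _ h
    exact ⟨Projectivization.mk ℂ _ h, (a⁻¹ : ℂˣ), by
      rw [← ha, ← Units.smul_def, inv_smul_smul]⟩

theorem sees_mk_of_seesAs {v w : Fin 4 → ℂ} (hv : v ≠ 0) (hw : w ≠ 0)
    (h : SeesAs P.cam Q.cam v w) {z : Fin n → Image} (hz : P.Sees (Projectivization.mk ℂ v hv) z) :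
    Q.Sees (Projectivization.mk ℂ w hw) z := by
  refine (sees_mk hw).mpr fun i ↦ ?_
  obtain ⟨c, hc⟩ := h i
  obtain ⟨a, ha⟩ := (sees_mk hv).mp hz i
  exact ⟨c * a, by rw [hc, ha, smul_smul]⟩

theorem seesAs_of_sees_mk {v w : Fin 4 → ℂ} (hv : v ≠ 0) (hw : w ≠ 0)
    (hPv : ∀ i, (P.cam i).mat.toComplex *ᵥ v ≠ 0) {z : Fin n → Image}
    (hPz : P.Sees (Projectivization.mk ℂ v hv) z) (hQz : Q.Sees (Projectivization.mk ℂ w hw) z) :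
    SeesAs P.cam Q.cam v w := by
  intro i
  obtain ⟨a, ha⟩ := (sees_mk hv).mp hPz i
  obtain ⟨c, hc⟩ := (sees_mk hw).mp hQz i
  have ha0 : a ≠ 0 := by
    rintro rfl
    exact hPv i (by rw [ha, zero_smul])
  exact ⟨c * a⁻¹, by rw [hc, ha, ← smul_smul, inv_smul_smul₀ ha0]⟩

theorem exists_common_reconstruction (hXY : ∀ x ∈ X, ∃ y ∈ Y, ∀ z, P.Sees x z → Q.Sees y z)
    (hYX : ∀ y ∈ Y, ∃ x ∈ X, ∀ z, P.Sees x z → Q.Sees y z) :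
    ∃ S, IsReconstruction S P X ∧ IsReconstruction S Q Y := by
  refine ⟨{z | ∃ x ∈ X, P.Sees x z}, ⟨fun z hz ↦ hz, fun x hx ↦ ?_⟩, fun z hz ↦ ?_, fun y hy ↦ ?_⟩
  · obtain ⟨z, hz⟩ := P.exists_sees x
    exact ⟨z, ⟨x, hx, hz⟩, hz⟩
  · obtain ⟨x, hx, hxz⟩ := hz
    obtain ⟨y, hy, hxy⟩ := hXY x hx
    exact ⟨y, hy, hxy z hxz⟩
  · obtain ⟨x, hx, hxy⟩ := hYX y hy
    obtain ⟨z, hz⟩ := P.exists_sees x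
    exact ⟨z, ⟨x, hx, hz⟩, hxy z hz⟩

end CameraTuple

/-- Three cameras with distinct centers `b i` on a real line that does not meet the standard twisted
cubic. -/
structure CollinearCameras (M : Fin 3 → Camera) (b : Fin 3 → Fin 4 → ℝ) : Prop where
  mulVec_center : ∀ i, (M i).mat *ᵥ b i = 0
  indep : ∀ i j, i ≠ j → LinearIndependent ℝ ![b i, b j]
  collinear : ∀ i j k, i ≠ j → b k ∈ Submodule.span ℝ {b i, b j}
  disjoint : ∀ i j (s t : ℂ), s ≠ 0 ∨ t ≠ 0 →
    momentVec 3 s t ∉ Submodule.span ℂ {complexVec (b i), complexVec (b j)}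

namespace CollinearCameras

variable {M : Fin 3 → Camera} {b : Fin 3 → Fin 4 → ℝ}

theorem center_ne_zero (h : CollinearCameras M b) (i : Fin 3) : b i ≠ 0 :=
  (h.indep i (i + 1) (by decide +revert)).ne_zero 0

theorem exists_eq_smul (h : CollinearCameras M b) (i : Fin 3) {v : Fin 4 → ℂ}
    (hv : (M i).mat.toComplex *ᵥ v = 0) : ∃ c : ℂ, v = c • complexVec (b i) :=
  Camera.exists_eq_smul (complexVec_eq_zero.not.mpr (h.center_ne_zero i))
    (by rw [complexVec_mulVec, h.mulVec_center, complexVec_eq_zero]) hv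

theorem mulVec_momentVec_ne_zero (h : CollinearCameras M b) (i : Fin 3) {s t : ℂ}
    (hst : s ≠ 0 ∨ t ≠ 0) : (M i).mat.toComplex *ᵥ momentVec 3 s t ≠ 0 := by
  intro h0
  obtain ⟨c, hc⟩ := h.exists_eq_smul i h0
  refine h.disjoint i i s t hst ?_
  rw [hc]
  exact Submodule.smul_mem _ c (Submodule.subset_span (Set.mem_insert _ _))

theorem not_three_on_ray (h : CollinearCameras M b) (i : Fin 3) {s₁ t₁ s₂ t₂ s₃ t₃ x y : ℂ}
    (h₁₂ : s₂ * t₁ - t₂ * s₁ ≠ 0) (h₁₃ : s₃ * t₁ - t₃ * s₁ ≠ 0) (h₂₃ : s₃ * t₂ - t₃ * s₂ ≠ 0)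
    (h₂ : (M i).mat.toComplex *ᵥ momentVec 3 s₂ t₂ = x • (M i).mat.toComplex *ᵥ momentVec 3 s₁ t₁)
    (h₃ : (M i).mat.toComplex *ᵥ momentVec 3 s₃ t₃ = y • (M i).mat.toComplex *ᵥ momentVec 3 s₁ t₁) :
    False := by
  obtain ⟨c, hc⟩ := h.exists_eq_smul i (v := momentVec 3 s₂ t₂ - x • momentVec 3 s₁ t₁) (by
    rw [Matrix.mulVec_sub, Matrix.mulVec_smul, h₂, sub_self])
  obtain ⟨c', hc'⟩ := h.exists_eq_smul i (v := momentVec 3 s₃ t₃ - y • momentVec 3 s₁ t₁) (by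
    rw [Matrix.mulVec_sub, Matrix.mulVec_smul, h₃, sub_self])
  have hc0 : c = 0 := by
    refine eq_zero_of_momentVec_combination (x := c' * x - c * y) (y := -c') h₁₃ h₂₃ ?_
    linear_combination (norm := module) c • hc' - c' • hc
  rw [hc0, zero_smul] at hc
  refine one_ne_zero (eq_zero_of_momentVec_combination (x := -x) (y := 0) h₁₂ h₁₂ ?_)
  linear_combination (norm := module) hc

end CollinearCameras

theorem mem_span_pair_of_finrank_eq_two {K V : Type*} [Field K] [AddCommGroup V] [Module K V]
    {W : Submodule K V} (hW : Module.finrank K W = 2) {u v w : V} (hu : u ∈ W) (hv : v ∈ W)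
    (hw : w ∈ W) (huv : LinearIndependent K ![u, v]) : w ∈ Submodule.span K {u, v} := by
  have : FiniteDimensional K W := Module.finite_of_finrank_eq_succ hW
  have hspan : Submodule.span K (Set.range ![u, v]) = W := by
    refine Submodule.eq_of_le_of_finrank_eq (Submodule.span_le.mpr ?_) ?_
    · simp [Set.insert_subset_iff, hu, hv]
    · rw [finrank_span_eq_card huv, Fintype.card_fin, hW]
  rwa [← Matrix.range_cons_cons_empty _ _ ![], hspan]

section Coordinates

variable {A : GL (Fin 4) ℝ} {P Q : Camera} {b b' : Fin 4 → ℝ}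

theorem toComplex_mulVec_complexVec_ne_zero (hb : b ≠ 0) :
    A.val.toComplex *ᵥ complexVec b ≠ 0 :=
  fun h ↦ hb (complexVec_eq_zero.mp
    (toComplex_mulVec_injective A (h.trans (Matrix.mulVec_zero _).symm)))

theorem Camera.center_eq_mk_of_changeCoords (hb : b ≠ 0)
    (hPb : (P.changeCoords A).mat *ᵥ b = 0) :
    P.center = Projectivization.mk ℂ (A.val.toComplex *ᵥ complexVec b)
      (toComplex_mulVec_complexVec_ne_zero hb) :=
  center_eq_mk _ (by
    rw [map_mulVec_map_mulVec]
    exact (complexVec_mulVec _ b).trans (complexVec_eq_zero.mpr hPb))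

theorem linearIndependent_of_center_ne (hb : b ≠ 0) (hb' : b' ≠ 0)
    (hPb : (P.changeCoords A).mat *ᵥ b = 0) (hQb : (Q.changeCoords A).mat *ᵥ b' = 0)
    (hne : P.center ≠ Q.center) : LinearIndependent ℝ ![b, b'] := by
  refine (LinearIndependent.pair_iff' hb).mpr fun x hx ↦ hne (Eq.symm ?_)
  rw [Camera.center_eq_mk_of_changeCoords hb hPb, Camera.center_eq_mk_of_changeCoords hb' hQb]
  refine projectivization_mk_eq_of_eq_smul _ _ (c := x) ?_
  rw [← Matrix.mulVec_smul, ← hx]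
  congr 1
  ext k
  simp

theorem mem_span_complexVec_of_mulVec_mem {v₁ v₂ w : Fin 4 → ℂ}
    (h : A.val.toComplex *ᵥ w ∈
      Submodule.span ℂ {A.val.toComplex *ᵥ v₁, A.val.toComplex *ᵥ v₂}) :
    w ∈ Submodule.span ℂ {v₁, v₂} := by
  obtain ⟨x, y, hxy⟩ := Submodule.mem_span_pair.mp h
  refine Submodule.mem_span_pair.mpr ⟨x, y, toComplex_mulVec_injective A ?_⟩
  simpa only [Matrix.mulVec_add, Matrix.mulVec_smul] using hxy

theorem exists_collinearCameras {P : CameraTuple 3} {L C : Set Space} (hL : IsLine L)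
    (hPL : ∀ i, (P.cam i).center ∈ L) (hC : IsTwistedCubic C) (hdisj : Disjoint C L) :
    ∃ (A : GL (Fin 4) ℝ) (b : Fin 3 → Fin 4 → ℝ),
      CollinearCameras (fun i ↦ (P.cam i).changeCoords A) b ∧ C = paramCurve 3 A.val := by
  obtain ⟨B, hB, hB0, rfl⟩ := hC
  obtain ⟨W, hW, rfl⟩ := hL
  obtain ⟨A, rfl⟩ : IsUnit B := Matrix.linearIndependent_rows_iff_isUnit.mp hB
  choose b hb hPb using fun i ↦ ((P.cam i).changeCoords A).exists_mulVec_eq_zero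
  have hbW (i) : A.val.toComplex *ᵥ complexVec (b i) ∈ W := by
    have hcenter := hPL i
    rw [Camera.center_eq_mk_of_changeCoords (hb i) (hPb i)] at hcenter
    simpa [Projectivization.submodule_mk] using hcenter
  have hindep (i j) (hij : i ≠ j) : LinearIndependent ℝ ![b i, b j] :=
    linearIndependent_of_center_ne (hb i) (hb j) (hPb i) (hPb j) (P.distinct_centers.ne hij)
  refine ⟨A, b, ⟨hPb, hindep, fun i j k hij ↦ ?_, fun i j s t hst hmem ↦ ?_⟩, rfl⟩
  · refine mem_span_pair_of_complexVec_mem (mem_span_complexVec_of_mulVec_mem (A := A) ?_)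
    refine mem_span_pair_of_finrank_eq_two hW (hbW i) (hbW j) (hbW k) ?_
    have hindepℂ := linearIndependent_complexVec_pair.mpr (hindep i j hij)
    refine LinearIndependent.pair_iff.mpr fun x y hxy ↦ LinearIndependent.pair_iff.mp hindepℂ x y
      (toComplex_mulVec_injective A ?_)
    simpa only [Matrix.mulVec_add, Matrix.mulVec_smul, Matrix.mulVec_zero] using hxy
  · have h0 := hB0 s t hst
    have hmemC : Projectivization.mk ℂ _ h0 ∈ paramCurve 3 A.val := ⟨s, t, h0, hst, rfl⟩
    refine Set.disjoint_left.mp hdisj hmemC ?_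
    rw [Set.mem_ofPred_eq, Projectivization.submodule_mk, Submodule.span_singleton_le_iff_mem]
    obtain ⟨x, y, hxy⟩ := Submodule.mem_span_pair.mp hmem
    change A.val.toComplex *ᵥ momentVec 3 s t ∈ W
    rw [← hxy, Matrix.mulVec_add, Matrix.mulVec_smul, Matrix.mulVec_smul]
    exact W.add_mem (W.smul_mem _ (hbW i)) (W.smul_mem _ (hbW j))

end Coordinates

section Windows

theorem exists_windows_mem (W : Submodule ℝ (Fin 4 → ℝ)) (hW : Module.finrank ℝ W = 2) :
    ∃ φ : Fin 5 → ℝ, φ ≠ 0 ∧ φ ∘ Fin.castSucc ∈ W ∧ φ ∘ Fin.succ ∈ W := by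
  let windows := (W.mkQ ∘ₗ LinearMap.funLeft ℝ ℝ (Fin.castSucc (n := 4))).prod
    (W.mkQ ∘ₗ LinearMap.funLeft ℝ ℝ (Fin.succ (n := 4)))
  have hquot := W.finrank_quotient_add_finrank
  rw [hW, Module.finrank_fin_fun] at hquot
  have hker : LinearMap.ker windows ≠ ⊥ := by
    refine LinearMap.ker_ne_bot_of_finrank_lt ?_
    rw [Module.finrank_prod, Module.finrank_fin_fun]
    omega
  obtain ⟨φ, hφ, hφ0⟩ := Submodule.exists_mem_ne_zero_of_ne_bot hker
  rw [LinearMap.ker_prod] at hφ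
  exact ⟨φ, hφ0, (Submodule.Quotient.mk_eq_zero W).mp hφ.1,
    (Submodule.Quotient.mk_eq_zero W).mp hφ.2⟩

theorem shiftMatrix_mulVec (l : Fin 2 → ℝ) (φ : Fin 5 → ℝ) :
    shiftMatrix l *ᵥ φ = l 0 • (φ ∘ Fin.castSucc) + l 1 • (φ ∘ Fin.succ) := by
  ext k
  simpa [linForm] using shiftMatrix_mulVec_apply (R := ℝ) l φ k

theorem exists_eq_smul_momentVec {φ : Fin 5 → ℝ} {l : Fin 2 → ℝ} (hl : l ≠ 0)
    (h : shiftMatrix l *ᵥ φ = 0) : ∃ c : ℝ, φ = c • momentVec 4 (l 1) (-l 0) := by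
  have hrec (k : Fin 4) : l 0 * φ k.castSucc + l 1 * φ k.succ = 0 := by
    simpa [shiftMatrix_mulVec] using congrFun h k
  have h₀ : l 0 * φ 0 + l 1 * φ 1 = 0 := hrec 0
  have h₁ : l 0 * φ 1 + l 1 * φ 2 = 0 := hrec 1
  have h₂ : l 0 * φ 2 + l 1 * φ 3 = 0 := hrec 2
  have h₃ : l 0 * φ 3 + l 1 * φ 4 = 0 := hrec 3
  by_cases hl₁ : l 1 = 0
  · have hl₀ : l 0 ≠ 0 := fun hl₀ ↦ hl (by ext k; fin_cases k <;> assumption)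
    simp only [hl₁, zero_mul, add_zero, mul_eq_zero, hl₀, false_or] at h₀ h₁ h₂ h₃
    refine ⟨φ 4 / l 0 ^ 4, ?_⟩
    ext k
    fin_cases k <;> simp [momentVec, *, (by decide : Even 4).neg_pow]
  · have hstep {x y : ℝ} (hxy : l 0 * x + l 1 * y = 0) : y = -l 0 / l 1 * x := by
      field_simp
      linear_combination hxy
    refine ⟨φ 0 / l 1 ^ 4, ?_⟩
    ext k
    fin_cases k <;> simp [momentVec, hstep h₃, hstep h₂, hstep h₁, hstep h₀] <;> field_simp

theorem exists_linearIndependent_row_mul_eq {K m : Type*} [Field K] {n : ℕ} {φ : Fin (n + 1) → K}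
    (hφ : φ ≠ 0) : ∃ B : Matrix (Fin n) (Fin (n + 1)) K, LinearIndependent K B.row ∧
      ∀ N : Matrix m (Fin (n + 1)) K, N *ᵥ φ = 0 → ∃ Q : Matrix m (Fin n) K, Q * B = N := by
  let f : Module.Dual K (Fin (n + 1) → K) := dotProductEquiv K _ φ
  have hrank : Module.finrank K (LinearMap.ker f) = n := by
    have hf : f ≠ 0 := (LinearEquiv.map_ne_zero_iff _).mpr hφ
    simpa using Module.Dual.finrank_ker_add_one_of_ne_zero hf
  let e := Module.finBasisOfFinrankEq K (LinearMap.ker f) hrank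
  refine ⟨Matrix.of fun i ↦ (e i : Fin (n + 1) → K),
    e.linearIndependent.map' (LinearMap.ker f).subtype (Submodule.ker_subtype _), fun N hN ↦ ?_⟩
  have hrow (a : m) : N a ∈ LinearMap.ker f := (dotProduct_comm φ (N a)).trans (congrFun hN a)
  refine ⟨Matrix.of fun a ↦ e.repr ⟨N a, hrow a⟩, funext fun a ↦ ?_⟩
  calc e.repr ⟨N a, hrow a⟩ ᵥ* Matrix.of (fun i ↦ (e i : Fin (n + 1) → K))
      = ((∑ i, e.repr ⟨N a, hrow a⟩ i • e i : LinearMap.ker f) : Fin (n + 1) → K) := by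
        rw [Matrix.vecMul_eq_sum, Submodule.coe_sum]
        rfl
    _ = N a := congrArg Subtype.val (e.sum_repr ⟨N a, hrow a⟩)

end Windows

/-- The cameras `T` see the quartic curve with coefficients `B` as the cameras `M` see the standard
twisted cubic, the image in the `i`-th view being multiplied by the linear form `l i`. -/
structure QuarticModel (M T : Fin 3 → Camera) (B : Matrix (Fin 4) (Fin 5) ℝ)
    (l : Fin 3 → Fin 2 → ℝ) : Prop where
  mul_eq : ∀ i, (T i).mat * B = (M i).mat * shiftMatrix (l i)
  rows : LinearIndependent ℝ B.row
  indep : ∀ i j, i ≠ j → l i 0 * l j 1 - l i 1 * l j 0 ≠ 0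

/-- The vector of quartic monomials at the zero of the linear form with coefficients `l`. -/
noncomputable abbrev rootVec (l : Fin 2 → ℝ) : Fin 5 → ℂ :=
  momentVec 4 (l 1 : ℂ) (-l 0 : ℂ)

theorem linForm_root (l : Fin 2 → ℝ) : linForm l (l 1 : ℂ) (-l 0 : ℂ) = 0 := by
  simp only [linForm, Complex.coe_algebraMap]
  ring

namespace QuarticModel

variable {M T : Fin 3 → Camera} {B : Matrix (Fin 4) (Fin 5) ℝ} {l : Fin 3 → Fin 2 → ℝ}
  {b : Fin 3 → Fin 4 → ℝ}

theorem mulVec_momentVec (h : QuarticModel M T B l) (i : Fin 3) (s t : ℂ) :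
    (T i).mat.toComplex *ᵥ (B.toComplex *ᵥ momentVec 4 s t) =
      linForm (l i) s t • (M i).mat.toComplex *ᵥ momentVec 3 s t := by
  rw [map_mulVec_map_mulVec, h.mul_eq, ← map_mulVec_map_mulVec, shiftMatrix_mulVec_momentVec,
    Matrix.mulVec_smul]

theorem eq_zero_of_linForm (h : QuarticModel M T B l) {i j : Fin 3} (hij : i ≠ j) {s t : ℂ}
    (hi : linForm (l i) s t = 0) (hj : linForm (l j) s t = 0) : s = 0 ∧ t = 0 := by
  have hdet : (l i 0 : ℂ) * l j 1 - l i 1 * l j 0 ≠ 0 := by exact_mod_cast h.indep i j hij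
  simp only [linForm, Complex.coe_algebraMap] at hi hj
  constructor
  · refine (mul_eq_zero.mp ?_).resolve_left hdet
    linear_combination (l j 1 : ℂ) * hi - (l i 1 : ℂ) * hj
  · refine (mul_eq_zero.mp ?_).resolve_left hdet
    linear_combination (l i 0 : ℂ) * hj - (l j 0 : ℂ) * hi

theorem linForm_ne_zero (h : QuarticModel M T B l) {i j : Fin 3} (hij : i ≠ j) {s t : ℂ}
    (hst : s ≠ 0 ∨ t ≠ 0) (hi : linForm (l i) s t = 0) : linForm (l j) s t ≠ 0 := by
  intro hj
  obtain ⟨rfl, rfl⟩ := h.eq_zero_of_linForm hij hi hj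
  simp at hst

theorem coeff_ne_zero (h : QuarticModel M T B l) (i : Fin 3) : l i ≠ 0 := by
  obtain ⟨j, hj⟩ := exists_ne i
  intro hi
  simpa [hi] using h.indep i j hj.symm

theorem root_ne_zero (h : QuarticModel M T B l) (i : Fin 3) :
    (l i 1 : ℂ) ≠ 0 ∨ (-l i 0 : ℂ) ≠ 0 := by
  by_contra! hi
  obtain ⟨h₁, h₀⟩ := hi
  refine h.coeff_ne_zero i (funext fun k ↦ ?_)
  fin_cases k
  · exact_mod_cast neg_eq_zero.mp h₀
  · exact_mod_cast h₁

theorem mulVec_rootVec (h : QuarticModel M T B l) (i : Fin 3) :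
    (T i).mat.toComplex *ᵥ (B.toComplex *ᵥ rootVec (l i)) = 0 := by
  rw [h.mulVec_momentVec, linForm_root, zero_smul]

theorem mulVec_momentVec_ne_zero (h : QuarticModel M T B l) (hM : CollinearCameras M b) {s t : ℂ}
    (hst : s ≠ 0 ∨ t ≠ 0) : B.toComplex *ᵥ momentVec 4 s t ≠ 0 := by
  intro h0
  have hl (i) : linForm (l i) s t = 0 := by
    have hi := h.mulVec_momentVec i s t
    rw [h0, Matrix.mulVec_zero, eq_comm, smul_eq_zero] at hi
    exact hi.resolve_right (hM.mulVec_momentVec_ne_zero i hst)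
  exact h.linForm_ne_zero (i := 0) (j := 1) (by decide) hst (hl 0) (hl 1)

theorem center_eq_mk (h : QuarticModel M T B l) (hM : CollinearCameras M b) (i : Fin 3) :
    (T i).center = Projectivization.mk ℂ (B.toComplex *ᵥ rootVec (l i))
      (h.mulVec_momentVec_ne_zero hM (h.root_ne_zero i)) :=
  Camera.center_eq_mk _ (h.mulVec_rootVec i)

theorem center_mem_paramCurve (h : QuarticModel M T B l) (hM : CollinearCameras M b) (i : Fin 3) :
    (T i).center ∈ paramCurve 4 B :=
  ⟨_, _, _, h.root_ne_zero i, h.center_eq_mk hM i⟩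

theorem center_injective (h : QuarticModel M T B l) (hM : CollinearCameras M b) :
    Function.Injective fun i ↦ (T i).center := by
  intro i j hij
  by_contra hne
  have hr := h.root_ne_zero j
  obtain ⟨c, hc⟩ := (Projectivization.mk_eq_mk_iff' ℂ _ _ _ _).mp
    ((h.center_eq_mk hM i).symm.trans (hij.trans (h.center_eq_mk hM j)))
  have hc0 : c ≠ 0 := by
    rintro rfl
    exact h.mulVec_momentVec_ne_zero hM (h.root_ne_zero i) (by rw [← hc, zero_smul])
  have hTi := h.mulVec_rootVec i
  rw [← hc, Matrix.mulVec_smul, smul_eq_zero_iff_right hc0, h.mulVec_momentVec, smul_eq_zero] at hTi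
  exact hTi.elim (h.linForm_ne_zero (Ne.symm hne) hr (linForm_root (l j)))
    (hM.mulVec_momentVec_ne_zero i hr)

theorem isRationalQuartic (h : QuarticModel M T B l) (hM : CollinearCameras M b) :
    IsRationalQuartic (paramCurve 4 B) :=
  ⟨B, h.rows, fun _ _ ↦ h.mulVec_momentVec_ne_zero hM, rfl⟩

theorem exists_distinct_linForm_ne_zero (h : QuarticModel M T B l) {s t : ℂ}
    (hst : s ≠ 0 ∨ t ≠ 0) : ∃ i j k : Fin 3, i ≠ j ∧ i ≠ k ∧ j ≠ k ∧
      linForm (l j) s t ≠ 0 ∧ linForm (l k) s t ≠ 0 := by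
  by_cases h₀ : linForm (l 0) s t = 0
  · exact ⟨0, 1, 2, by decide, by decide, by decide, h.linForm_ne_zero (by decide) hst h₀,
      h.linForm_ne_zero (by decide) hst h₀⟩
  by_cases h₁ : linForm (l 1) s t = 0
  · exact ⟨1, 0, 2, by decide, by decide, by decide, h₀, h.linForm_ne_zero (by decide) hst h₁⟩
  · exact ⟨2, 0, 1, by decide, by decide, by decide, h₀, h₁⟩

/- The `j`-th camera places `y` on the line joining the point with parameter `(s, t)` to its center,
and the `i`-th camera sees these three points on a single ray. -/
theorem exists_root_on_ray (h : QuarticModel M T B l) (hM : CollinearCameras M b) {s t : ℂ}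
    {y : Fin 4 → ℂ} (hy : SeesAs M T (momentVec 3 s t) y)
    (hne : ¬∃ c : ℂ, y = c • B.toComplex *ᵥ momentVec 4 s t) {i j : Fin 3} (hij : i ≠ j)
    (hj : linForm (l j) s t ≠ 0) :
    ∃ x : ℂ, (M i).mat.toComplex *ᵥ momentVec 3 (l j 1 : ℂ) (-l j 0 : ℂ) =
      x • (M i).mat.toComplex *ᵥ momentVec 3 s t := by
  choose γ hγ using hy
  obtain ⟨c, hc⟩ : ∃ c : ℂ, linForm (l j) s t • y - γ j • B.toComplex *ᵥ momentVec 4 s t =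
      c • B.toComplex *ᵥ rootVec (l j) := by
    refine Camera.exists_eq_smul (h.mulVec_momentVec_ne_zero hM (h.root_ne_zero j))
      (h.mulVec_rootVec j) ?_
    rw [Matrix.mulVec_sub, Matrix.mulVec_smul, Matrix.mulVec_smul, hγ, h.mulVec_momentVec,
      smul_smul, smul_smul, mul_comm, sub_self]
  have hc0 : c ≠ 0 := by
    rintro rfl
    rw [zero_smul, sub_eq_zero] at hc
    exact hne ⟨(linForm (l j) s t)⁻¹ * γ j, by rw [← smul_smul, ← hc, inv_smul_smul₀ hj]⟩
  have hu := mul_ne_zero hc0 (h.linForm_ne_zero hij.symm (h.root_ne_zero j) (linForm_root (l j)))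
  have hi := congrArg ((T i).mat.toComplex *ᵥ ·) hc
  simp only [Matrix.mulVec_sub, Matrix.mulVec_smul, hγ, h.mulVec_momentVec, smul_smul,
    ← sub_smul] at hi
  exact ⟨(c * linForm (l i) (l j 1 : ℂ) (-l j 0 : ℂ))⁻¹ *
    (linForm (l j) s t * γ i - γ j * linForm (l i) s t), by
      rw [← smul_smul, hi, inv_smul_smul₀ hu]⟩

theorem eq_smul_of_seesAs (h : QuarticModel M T B l) (hM : CollinearCameras M b) {s t : ℂ}
    (hst : s ≠ 0 ∨ t ≠ 0) {y : Fin 4 → ℂ} (hy : SeesAs M T (momentVec 3 s t) y) :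
    ∃ c : ℂ, y = c • B.toComplex *ᵥ momentVec 4 s t := by
  by_contra hne
  obtain ⟨i, j, k, hij, hik, hjk, hj, hk⟩ := h.exists_distinct_linForm_ne_zero hst
  obtain ⟨x, hx⟩ := h.exists_root_on_ray hM hy hne hij hj
  obtain ⟨x', hx'⟩ := h.exists_root_on_ray hM hy hne hik hk
  have hdet : (l j 0 : ℂ) * l k 1 - l j 1 * l k 0 ≠ 0 := by exact_mod_cast h.indep j k hjk
  simp only [linForm, Complex.coe_algebraMap] at hj hk
  refine hM.not_three_on_ray i (fun h0 ↦ hj ?_) (fun h0 ↦ hk ?_) (fun h0 ↦ hdet ?_) hx hx'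
  · linear_combination h0
  · linear_combination h0
  · linear_combination -h0

end QuarticModel

theorem shiftMatrix_vecMul_eq_zero {l : Fin 2 → ℝ} (hl : l ≠ 0) {v : Fin 4 → ℝ}
    (hv : v ᵥ* shiftMatrix l = 0) : v = 0 := by
  have e₀ := congrFun hv 0
  have e₁ := congrFun hv 1
  have e₂ := congrFun hv 2
  have e₃ := congrFun hv 3
  have e₄ := congrFun hv 4
  simp only [Matrix.vecMul, dotProduct, shiftMatrix, Fin.isValue, Matrix.of_apply,
    Matrix.cons_val', Matrix.cons_val_zero, Matrix.cons_val_fin_one, Fin.sum_univ_four,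
    Matrix.cons_val_one, mul_zero, add_zero, Matrix.cons_val, Pi.zero_apply, mul_eq_zero,
    zero_add] at e₀ e₁ e₂ e₃ e₄
  by_cases hl₀ : l 0 = 0
  · have hl₁ : l 1 ≠ 0 := fun hl₁ ↦ hl (by ext k; fin_cases k <;> assumption)
    simp only [hl₀, hl₁, mul_zero, add_zero, mul_eq_zero, or_false] at e₁ e₂ e₃ e₄
    ext k
    fin_cases k <;> assumption
  · simp only [hl₀, or_false] at e₀
    simp only [e₀, zero_mul, zero_add, mul_eq_zero, hl₀, or_false] at e₁
    simp only [e₁, zero_mul, zero_add, mul_eq_zero, hl₀, or_false] at e₂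
    simp only [e₂, zero_mul, zero_add, mul_eq_zero, hl₀, or_false] at e₃
    ext k
    fin_cases k <;> assumption

theorem rank_eq_of_mul_eq_mul_shiftMatrix {P : Camera} {l : Fin 2 → ℝ} (hl : l ≠ 0)
    {Q : Matrix (Fin 3) (Fin 4) ℝ} {B : Matrix (Fin 4) (Fin 5) ℝ}
    (h : Q * B = P.mat * shiftMatrix l) : Q.rank = 3 := by
  have hrow : LinearIndependent ℝ Q.row := by
    refine Matrix.vecMul_injective_iff.mp
      ((injective_iff_map_eq_zero (Matrix.vecMulLinear Q)).mpr fun u hu ↦ ?_)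
    have hshift : (u ᵥ* P.mat) ᵥ* shiftMatrix l = 0 := by
      rw [Matrix.vecMul_vecMul, ← h, ← Matrix.vecMul_vecMul]
      exact (congrArg (· ᵥ* B) hu).trans (Matrix.zero_vecMul B)
    obtain ⟨G, hG⟩ := P.exists_right_inv
    rw [← Matrix.vecMul_one u, ← hG, ← Matrix.vecMul_vecMul, shiftMatrix_vecMul_eq_zero hl hshift,
      Matrix.zero_vecMul]
  simpa using hrow.rank_matrix

theorem det_ne_zero_of_shiftMatrix_mulVec_eq {v w : Fin 4 → ℝ} {l l' : Fin 2 → ℝ} {φ : Fin 5 → ℝ}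
    (hl : shiftMatrix l *ᵥ φ = v) (hl' : shiftMatrix l' *ᵥ φ = w)
    (hvw : LinearIndependent ℝ ![v, w]) : l 0 * l' 1 - l 1 * l' 0 ≠ 0 := by
  intro hdet
  have hv : l ≠ 0 := by
    rintro rfl
    exact hvw.ne_zero 0 (by simp [← hl, shiftMatrix_mulVec])
  have hk : ∀ k, l' k • v + -l k • w = 0 := by
    rw [← hl, ← hl', shiftMatrix_mulVec, shiftMatrix_mulVec]
    refine Fin.forall_fin_two.mpr ⟨?_, ?_⟩ <;> ext a <;>
      simp only [Pi.add_apply, Pi.smul_apply, smul_eq_mul, Pi.zero_apply, Function.comp_apply]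
    · linear_combination (-φ a.succ) * hdet
    · linear_combination φ a.castSucc * hdet
  exact hv (funext fun k ↦ neg_eq_zero.mp (LinearIndependent.pair_iff.mp hvw _ _ (hk k)).2)

namespace CollinearCameras

variable {M : Fin 3 → Camera} {b : Fin 3 → Fin 4 → ℝ}

theorem momentVec_notMem (h : CollinearCameras M b) (i j : Fin 3) {s t : ℝ}
    (hst : s ≠ 0 ∨ t ≠ 0) : momentVec 3 s t ∉ Submodule.span ℝ {b i, b j} := by
  intro hmem
  obtain ⟨x, y, hxy⟩ := Submodule.mem_span_pair.mp hmem
  refine h.disjoint i j s t (by exact_mod_cast hst)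
    (Submodule.mem_span_pair.mpr ⟨x, y, funext fun k ↦ ?_⟩)
  simpa [momentVec] using congrArg Complex.ofReal (congrFun hxy k)

theorem linearIndependent_windows (h : CollinearCameras M b) (i j : Fin 3) {φ : Fin 5 → ℝ}
    (hφ : φ ≠ 0) (hinit : φ ∘ Fin.castSucc ∈ Submodule.span ℝ {b i, b j})
    (htail : φ ∘ Fin.succ ∈ Submodule.span ℝ {b i, b j}) :
    LinearIndependent ℝ ![φ ∘ Fin.castSucc, φ ∘ Fin.succ] := by
  refine LinearIndependent.pair_iff.mpr fun x y hxy ↦ ?_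
  by_contra hne
  have hl : ![x, y] ≠ 0 := fun h0 ↦ hne ⟨congrFun h0 0, congrFun h0 1⟩
  obtain ⟨c, rfl⟩ : ∃ c : ℝ, φ = c • momentVec 4 y (-x) :=
    exists_eq_smul_momentVec hl ((shiftMatrix_mulVec _ _).trans hxy)
  have hc : c ≠ 0 := fun hc ↦ hφ (by rw [hc, zero_smul])
  have hy : (c * y) • momentVec 3 y (-x) ∈ Submodule.span ℝ {b i, b j} := by
    convert hinit using 1
    ext k
    fin_cases k <;> simp [momentVec] <;> ring
  have hx : (c * -x) • momentVec 3 y (-x) ∈ Submodule.span ℝ {b i, b j} := by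
    convert htail using 1
    ext k
    fin_cases k <;> simp [momentVec] <;> ring
  have hyx : y ≠ 0 ∨ -x ≠ 0 := by
    by_contra! h0
    exact hne ⟨neg_eq_zero.mp h0.2, h0.1⟩
  refine h.momentVec_notMem i j hyx (hyx.elim (fun hy0 ↦ ?_) fun hx0 ↦ ?_)
  · exact (Submodule.smul_mem_iff _ (mul_ne_zero hc hy0)).mp hy
  · exact (Submodule.smul_mem_iff _ (mul_ne_zero hc hx0)).mp hx

theorem exists_shiftMatrix_mulVec_eq (h : CollinearCameras M b) :
    ∃ φ : Fin 5 → ℝ, φ ≠ 0 ∧ ∃ l : Fin 3 → Fin 2 → ℝ, ∀ i, shiftMatrix (l i) *ᵥ φ = b i := by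
  have h₀₁ := h.indep 0 1 (by decide)
  have hfinrank : Module.finrank ℝ (Submodule.span ℝ {b 0, b 1}) = 2 := by
    rw [← Matrix.range_cons_cons_empty _ _ ![], finrank_span_eq_card h₀₁, Fintype.card_fin]
  obtain ⟨φ, hφ, hinit, htail⟩ := exists_windows_mem _ hfinrank
  suffices hl : ∀ i, ∃ l, shiftMatrix l *ᵥ φ = b i from ⟨φ, hφ, Classical.skolem.mp hl⟩
  intro i
  have hbi : b i ∈ Submodule.span ℝ {b 0, b 1} := by
    fin_cases i
    · exact Submodule.subset_span (by simp)
    · exact Submodule.subset_span (by simp)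
    · exact h.collinear 0 1 2 (by decide)
  obtain ⟨x, y, hxy⟩ := Submodule.mem_span_pair.mp (mem_span_pair_of_finrank_eq_two hfinrank
    hinit htail hbi (h.linearIndependent_windows 0 1 hφ hinit htail))
  exact ⟨![x, y], (shiftMatrix_mulVec _ _).trans hxy⟩

theorem exists_quarticModel (h : CollinearCameras M b) :
    ∃ (T : CameraTuple 3) (B : Matrix (Fin 4) (Fin 5) ℝ) (l : Fin 3 → Fin 2 → ℝ),
      QuarticModel M T.cam B l := by
  obtain ⟨φ, hφ, l, hl⟩ := h.exists_shiftMatrix_mulVec_eq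
  have hdet (i j) (hij : i ≠ j) : l i 0 * l j 1 - l i 1 * l j 0 ≠ 0 :=
    det_ne_zero_of_shiftMatrix_mulVec_eq (hl i) (hl j) (h.indep i j hij)
  have hl0 (i) : l i ≠ 0 := by
    intro h0
    exact h.center_ne_zero i (by simp [← hl, h0, shiftMatrix_mulVec])
  obtain ⟨B, hB, hmul⟩ := exists_linearIndependent_row_mul_eq (m := Fin 3) hφ
  choose Q hQ using fun i ↦ hmul ((M i).mat * shiftMatrix (l i)) (by
    rw [← Matrix.mulVec_mulVec, hl, h.mulVec_center])
  let T (i : Fin 3) : Camera := ⟨Q i, rank_eq_of_mul_eq_mul_shiftMatrix (hl0 i) (hQ i)⟩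
  have hT : QuarticModel M T B l := ⟨hQ, hB, hdet⟩
  exact ⟨⟨T, hT.center_injective h⟩, B, l, hT⟩

end CollinearCameras

section FundamentalForm

variable {P P' : Camera} {u v : Fin 3 → ℝ}

/-- The matrix whose determinant is `fundamentalForm P P' u v`. -/
def epipolarMatrix (P P' : Camera) (u v : Fin 3 → ℝ) :
    Matrix (Fin 3 ⊕ Fin 3) (Fin 4 ⊕ Fin 2) ℝ :=
  Matrix.fromBlocks P.mat (Matrix.of fun k (l : Fin 2) ↦ if l = 0 then u k else 0)
    P'.mat (Matrix.of fun k (l : Fin 2) ↦ if l = 0 then 0 else v k)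

theorem epipolarMatrix_mulVec (x : Fin 4 → ℝ) (w : Fin 2 → ℝ) :
    epipolarMatrix P P' u v *ᵥ Sum.elim x w =
      Sum.elim (P.mat *ᵥ x + w 0 • u) (P'.mat *ᵥ x + w 1 • v) := by
  rw [epipolarMatrix, Matrix.fromBlocks_mulVec]
  congr 1 <;> ext k <;> simp [Matrix.mulVec, dotProduct, mul_comm]

theorem fundamentalForm_eq_zero_iff_exists_mulVec_eq_zero :
    fundamentalForm P P' u v = 0 ↔ ∃ y ≠ 0, epipolarMatrix P P' u v *ᵥ y = 0 := by
  rw [fundamentalForm, ← Matrix.exists_mulVec_eq_zero_iff]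
  let e : (Fin 4 ⊕ Fin 2 → ℝ) ≃ₗ[ℝ] (Fin 6 → ℝ) := LinearEquiv.funCongrLeft ℝ ℝ
    (finSumFinEquiv (m := 4) (n := 2)).symm
  refine (e.toEquiv.exists_congr fun y ↦ and_congr e.map_ne_zero_iff.symm ?_).symm
  rw [Matrix.reindex_apply, ← epipolarMatrix, Matrix.submatrix_mulVec_equiv, Equiv.symm_symm,
    Equiv.comp_symm_eq]
  have he : (e.toEquiv y) ∘ finSumFinEquiv = y := e.symm_apply_apply y
  rw [he, Pi.zero_comp]

theorem fundamentalForm_eq_zero_iff : fundamentalForm P P' u v = 0 ↔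
    ∃ (x : Fin 4 → ℝ) (α β : ℝ), (x ≠ 0 ∨ α ≠ 0 ∨ β ≠ 0) ∧
      P.mat *ᵥ x + α • u = 0 ∧ P'.mat *ᵥ x + β • v = 0 := by
  rw [fundamentalForm_eq_zero_iff_exists_mulVec_eq_zero]
  have helim {α β : Type} (f : α → ℝ) (g : β → ℝ) : Sum.elim f g = 0 ↔ f = 0 ∧ g = 0 := by
    rw [← Sum.elim_zero_zero, Sum.elim_eq_iff]
  constructor
  · rintro ⟨y, hy0, hy⟩
    rw [← Sum.elim_comp_inl_inr y] at hy0 hy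
    rw [epipolarMatrix_mulVec, helim] at hy
    refine ⟨_, _, _, ?_, hy⟩
    contrapose! hy0
    obtain ⟨hx, hα, hβ⟩ := hy0
    exact (helim _ _).mpr ⟨hx, funext (Fin.forall_fin_two.mpr ⟨hα, hβ⟩)⟩
  · rintro ⟨x, α, β, hne, hx⟩
    refine ⟨Sum.elim x ![α, β], fun h0 ↦ ?_, ?_⟩
    · obtain ⟨hx, hαβ⟩ := (helim _ _).mp h0
      exact hne.elim (· hx) (Or.elim · (· (congrFun hαβ 0)) (· (congrFun hαβ 1)))
    · rw [epipolarMatrix_mulVec, helim]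
      exact hx

theorem fundamentalForm_eq_zero_of_smul_eq {x : Fin 4 → ℝ} {c c' : ℝ} (hc : c ≠ 0)
    (hu : c • u = P.mat *ᵥ x) (hv : c' • v = P'.mat *ᵥ x) : fundamentalForm P P' u v = 0 :=
  fundamentalForm_eq_zero_iff.mpr ⟨x, -c, -c', Or.inr (Or.inl (neg_ne_zero.mpr hc)),
    by rw [← hu, ← add_smul, add_neg_cancel, zero_smul],
    by rw [← hv, ← add_smul, add_neg_cancel, zero_smul]⟩

theorem fundamentalForm_changeCoords_eq_zero (A : GL (Fin 4) ℝ)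
    (h : fundamentalForm P P' u v = 0) :
    fundamentalForm (P.changeCoords A) (P'.changeCoords A) u v = 0 := by
  obtain ⟨x, α, β, hne, hx⟩ := fundamentalForm_eq_zero_iff.mp h
  have hAx : A.val *ᵥ ((A⁻¹).val *ᵥ x) = x := by
    rw [Matrix.mulVec_mulVec, ← Units.val_mul, mul_inv_cancel, Units.val_one, Matrix.one_mulVec]
  refine fundamentalForm_eq_zero_iff.mpr ⟨(A⁻¹).val *ᵥ x, α, β, hne.imp_left fun hx0 h0 ↦ ?_, ?_⟩
  · exact hx0 (by rw [← hAx, h0, Matrix.mulVec_zero])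
  · simpa only [Camera.changeCoords, ← Matrix.mulVec_mulVec, hAx] using hx

end FundamentalForm

theorem CollinearCameras.exists_momentVec_indep {M : Fin 3 → Camera} {b : Fin 3 → Fin 4 → ℝ}
    (h : CollinearCameras M b) (i j : Fin 3) : ∃ s t : ℝ, t ≠ 0 ∧ ∀ x y : ℝ,
      x • momentVec 3 1 0 + y • momentVec 3 s t ∈ Submodule.span ℝ {b i, b j} → x = 0 ∧ y = 0 := by
  let N : Matrix (Fin 3) (Fin 4) ℝ := Matrix.of ![momentVec 3 1 0, b i, b j]
  have hker : LinearMap.ker N.mulVecLin ≠ ⊥ := LinearMap.ker_ne_bot_of_finrank_lt (by simp)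
  obtain ⟨g, hNg, hg⟩ := Submodule.exists_mem_ne_zero_of_ne_bot hker
  replace hNg : N *ᵥ g = 0 := hNg
  have h₀ : momentVec 3 1 0 ⬝ᵥ g = 0 := congrFun hNg 0
  have hspan (v) (hv : v ∈ Submodule.span ℝ {b i, b j}) : v ⬝ᵥ g = 0 := by
    obtain ⟨x, y, rfl⟩ := Submodule.mem_span_pair.mp hv
    have hi : b i ⬝ᵥ g = 0 := congrFun hNg 1
    have hj : b j ⬝ᵥ g = 0 := congrFun hNg 2
    rw [add_dotProduct, smul_dotProduct, smul_dotProduct, hi, hj, smul_zero, smul_zero, add_zero]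
  by_contra! hdep
  -- Otherwise `g` vanishes on the whole cubic, which spans the space.
  have hcubic (s t : ℝ) (ht : t ≠ 0) : momentVec 3 s t ⬝ᵥ g = 0 := by
    obtain ⟨x, y, hxy, hne⟩ := hdep s t ht
    have hy : y ≠ 0 := by
      rintro rfl
      rw [zero_smul, add_zero, Submodule.smul_mem_iff _ fun hx ↦ hne hx rfl] at hxy
      exact h.momentVec_notMem i j (Or.inl one_ne_zero) hxy
    simpa [add_dotProduct, h₀, hy] using hspan _ hxy
  have h₁ := hcubic 0 1 one_ne_zero
  have h₂ := hcubic 1 1 one_ne_zero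
  have h₃ := hcubic 1 (-1) (by norm_num)
  simp only [dotProduct, Nat.reduceAdd, momentVec, one_pow, one_mul, Fin.sum_univ_four,
    Fin.isValue, Fin.coe_ofNat_eq_mod, Nat.zero_mod, pow_zero, Nat.one_mod, pow_one, zero_mul,
    add_zero, Nat.reduceMod, ne_eq, OfNat.ofNat_ne_zero, not_false_eq_true, zero_pow, Nat.mod_succ,
    mul_one, tsub_zero, Nat.add_one_sub_one, Nat.reduceSub, tsub_self, zero_add, neg_mul, even_two,
    Even.neg_pow] at h₀ h₁ h₂ h₃
  refine hg (funext fun k ↦ ?_)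
  fin_cases k <;> simp <;> linarith

theorem CollinearCameras.exists_eq_smul_real {M : Fin 3 → Camera} {b : Fin 3 → Fin 4 → ℝ}
    (h : CollinearCameras M b) (i : Fin 3) {v : Fin 4 → ℝ} (hv : (M i).mat *ᵥ v = 0) :
    ∃ c : ℝ, v = c • b i := by
  obtain ⟨c, hc⟩ := h.exists_eq_smul i (v := complexVec v)
    (by rw [complexVec_mulVec, hv, complexVec_eq_zero])
  exact ⟨c.re, funext fun k ↦ by simpa using congrArg Complex.re (congrFun hc k)⟩

namespace QuarticModel

variable {M T : Fin 3 → Camera} {B : Matrix (Fin 4) (Fin 5) ℝ} {l : Fin 3 → Fin 2 → ℝ}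
  {b : Fin 3 → Fin 4 → ℝ}

theorem mulVec_momentVec_real (h : QuarticModel M T B l) (i : Fin 3) (s t : ℝ) :
    (T i).mat *ᵥ (B *ᵥ momentVec 4 s t) =
      (M i).mat *ᵥ ((l i 0 * s + l i 1 * t) • momentVec 3 s t) := by
  rw [Matrix.mulVec_mulVec, h.mul_eq, ← Matrix.mulVec_mulVec]
  congr 1
  simpa [linForm] using shiftMatrix_mulVec_momentVec (R := ℝ) (l i) s t

theorem not_forall_fundamentalForm_eq_zero (h : QuarticModel M T B l) (hM : CollinearCameras M b)
    {i j : Fin 3} (hij : i ≠ j) :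
    ¬∀ y, fundamentalForm (M i) (M j) ((T i).mat *ᵥ y) ((T j).mat *ᵥ y) = 0 := by
  intro h0
  -- The form is nonzero at the images of the point halfway between two points of the quartic.
  obtain ⟨s, t, ht, hindep⟩ := hM.exists_momentVec_indep i j
  obtain ⟨x, α, β, hne, hi, hj⟩ := fundamentalForm_eq_zero_iff.mp
    (h0 (B *ᵥ momentVec 4 1 0 + B *ᵥ momentVec 4 s t))
  simp only [Matrix.mulVec_add, h.mulVec_momentVec_real] at hi hj
  rw [← Matrix.mulVec_add, ← Matrix.mulVec_smul, ← Matrix.mulVec_add] at hi hj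
  obtain ⟨z, hz⟩ := hM.exists_eq_smul_real i hi
  obtain ⟨w, hw⟩ := hM.exists_eq_smul_real j hj
  obtain ⟨h₀, h₁⟩ := hindep (α * l i 0 - β * l j 0)
    (α * (l i 0 * s + l i 1 * t) - β * (l j 0 * s + l j 1 * t))
    (Submodule.mem_span_pair.mpr ⟨z, -w, by linear_combination (norm := module) hw - hz⟩)
  have h₂ : α * l i 1 - β * l j 1 = 0 :=
    (mul_eq_zero.mp (by linear_combination h₁ - s * h₀)).resolve_right ht
  have hdet := h.indep i j hij
  obtain rfl : α = 0 :=
    (mul_eq_zero.mp (by linear_combination l j 1 * h₀ - l j 0 * h₂)).resolve_right hdet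
  obtain rfl : β = 0 :=
    (mul_eq_zero.mp (by linear_combination l i 1 * h₀ - l i 0 * h₂)).resolve_right hdet
  rw [zero_smul, add_zero] at hz hw
  have hzw := LinearIndependent.pair_iff.mp (hM.indep i j hij) z (-w)
    (by linear_combination (norm := module) hw - hz)
  simp [hz, hzw.1] at hne

theorem not_sameFundamental {P : Fin 3 → Camera} {A : GL (Fin 4) ℝ}
    (h : QuarticModel (fun i ↦ (P i).changeCoords A) T B l)
    (hM : CollinearCameras (fun i ↦ (P i).changeCoords A) b) {i j : Fin 3} (hij : i ≠ j) :
    ¬SameFundamental (P i) (P j) (T i) (T j) := by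
  rintro ⟨c, -, hF⟩
  refine h.not_forall_fundamentalForm_eq_zero hM hij fun y ↦
    fundamentalForm_changeCoords_eq_zero A ?_
  rw [hF, fundamentalForm_eq_zero_of_smul_eq one_ne_zero (one_smul ℝ _) (one_smul ℝ _), mul_zero]

theorem not_camerasEquivVia {P T : CameraTuple 3} {A : GL (Fin 4) ℝ}
    (h : QuarticModel (fun i ↦ (P.cam i).changeCoords A) T.cam B l)
    (hM : CollinearCameras (fun i ↦ (P.cam i).changeCoords A) b) (H : GL (Fin 4) ℝ) :
    ¬CamerasEquivVia H P T := by
  intro hH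
  obtain ⟨c, hc, hcT⟩ := hH 0
  obtain ⟨c', -, hcT'⟩ := hH 1
  refine h.not_forall_fundamentalForm_eq_zero hM (i := 0) (j := 1) (by decide) fun y ↦
    fundamentalForm_changeCoords_eq_zero A
      (fundamentalForm_eq_zero_of_smul_eq (x := (H⁻¹).val *ᵥ y) hc ?_ (c' := c') ?_)
  · rw [Matrix.mulVec_mulVec, hcT, Matrix.smul_mulVec]
  · rw [Matrix.mulVec_mulVec, hcT', Matrix.smul_mulVec]

end QuarticModel

theorem seesAs_changeCoords {n : ℕ} {P Q : Fin n → Camera} {A : GL (Fin 4) ℝ} {v w : Fin 4 → ℂ} :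
    SeesAs (fun i ↦ (P i).changeCoords A) Q v w ↔ SeesAs P Q (A.val.toComplex *ᵥ v) w := by
  simp only [SeesAs, Camera.changeCoords, map_mulVec_map_mulVec]

/-- The points of the curve with coefficients `B` over a set `X` of points of the cubic with
coefficients `A`, under the common parametrization by binary forms. -/
def pointsOver (A : Matrix (Fin 4) (Fin 4) ℝ) (B : Matrix (Fin 4) (Fin 5) ℝ) (X : Set Space) :
    Set Space :=
  {y | ∃ (s t : ℂ) (hA : A.toComplex *ᵥ momentVec 3 s t ≠ 0)
    (hB : B.toComplex *ᵥ momentVec 4 s t ≠ 0),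
      Projectivization.mk ℂ _ hA ∈ X ∧ y = Projectivization.mk ℂ _ hB}

theorem pointsOver_mono {A : Matrix (Fin 4) (Fin 4) ℝ} {B : Matrix (Fin 4) (Fin 5) ℝ}
    {X Y : Set Space} (h : X ⊆ Y) : pointsOver A B X ⊆ pointsOver A B Y :=
  fun _ ⟨s, t, hA, hB, hX, hy⟩ ↦ ⟨s, t, hA, hB, h hX, hy⟩

theorem QuarticModel.isNontrivialConjugate {P T : CameraTuple 3} {A : GL (Fin 4) ℝ}
    {B : Matrix (Fin 4) (Fin 5) ℝ} {l : Fin 3 → Fin 2 → ℝ} {b : Fin 3 → Fin 4 → ℝ}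
    (h : QuarticModel (fun i ↦ (P.cam i).changeCoords A) T.cam B l)
    (hM : CollinearCameras (fun i ↦ (P.cam i).changeCoords A) b) {X : Set Space}
    (hX : X ⊆ paramCurve 3 A.val) : IsNontrivialConjugate P X T (pointsOver A.val B X) := by
  have hsees (s t : ℂ) : SeesAs P.cam T.cam (A.val.toComplex *ᵥ momentVec 3 s t)
      (B.toComplex *ᵥ momentVec 4 s t) :=
    seesAs_changeCoords.mp fun i ↦ ⟨_, h.mulVec_momentVec i s t⟩
  refine ⟨⟨CameraTuple.exists_common_reconstruction (fun x hx ↦ ?_) fun y hy ↦ ?_, ?_⟩,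
    fun i j hij ↦ h.not_sameFundamental hM hij⟩
  · obtain ⟨s, t, hA, hst, rfl⟩ := hX hx
    have hB := h.mulVec_momentVec_ne_zero hM hst
    exact ⟨_, ⟨s, t, hA, hB, hx, rfl⟩, fun z ↦ CameraTuple.sees_mk_of_seesAs hA hB (hsees s t)⟩
  · obtain ⟨s, t, hA, hB, hx, rfl⟩ := hy
    exact ⟨_, hx, fun z ↦ CameraTuple.sees_mk_of_seesAs hA hB (hsees s t)⟩
  · rintro ⟨H, -, hH⟩
    exact h.not_camerasEquivVia hM H hH

section Polynomials

open Polynomial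

theorem exists_polynomial_mulVec_eq_zero {m n : Type*} [Finite m] [Fintype n]
    {T : Matrix m n ℝ[X]} (h : ∀ τ : ℝ, ∃ v : n → ℂ, v ≠ 0 ∧ T.map (aeval (τ : ℂ)) *ᵥ v = 0) :
    ∃ v ≠ 0, T *ᵥ v = 0 := by
  classical
  cases nonempty_fintype m
  have hdet : (Tᵀ * T).det = 0 := by
    refine Polynomial.funext fun τ ↦ ?_
    obtain ⟨v, hv, hTv⟩ := h τ
    have h0 : aeval (τ : ℂ) (Tᵀ * T).det = 0 := by
      rw [AlgHom.map_det, AlgHom.mapMatrix_apply, Matrix.map_mul]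
      refine Matrix.exists_mulVec_eq_zero_iff.mp ⟨v, hv, ?_⟩
      rw [← Matrix.mulVec_mulVec, hTv, Matrix.mulVec_zero]
    rw [← Complex.coe_algebraMap, aeval_algebraMap_apply] at h0
    simpa using h0
  obtain ⟨v, hv, hTv⟩ := Matrix.exists_mulVec_eq_zero_iff.mpr hdet
  refine ⟨v, hv, ?_⟩
  -- `T v` is orthogonal to itself, hence so are its values at the real points.
  have horth : (T *ᵥ v) ⬝ᵥ (T *ᵥ v) = 0 := by
    rw [Matrix.dotProduct_mulVec, Matrix.vecMul_mulVec, ← Matrix.dotProduct_mulVec, hTv,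
      dotProduct_zero]
  ext1 p
  refine Polynomial.funext fun τ ↦ ?_
  have hτ : (eval τ ∘ (T *ᵥ v)) ⬝ᵥ (eval τ ∘ (T *ᵥ v)) = 0 := by
    simpa [dotProduct, eval_finsetSum] using congrArg (eval τ) horth
  simpa using congrFun (dotProduct_self_eq_zero.mp hτ) p

/-- The linear system `Qᵢ y = cᵢ vᵢ` in the unknowns `y` and `c`. -/
noncomputable def triangulationMatrix {n : ℕ} {R : Type*} [CommRing R] [Algebra ℝ R]
    (Q : Fin n → Camera) (v : Fin n → Fin 3 → R) : Matrix (Fin n × Fin 3) (Fin 4 ⊕ Fin n) R :=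
  Matrix.of fun p ↦ Sum.elim (fun k ↦ algebraMap ℝ R ((Q p.1).mat p.2 k))
    (Pi.single p.1 (-v p.1 p.2))

theorem triangulationMatrix_mulVec_eq_zero {n : ℕ} {R : Type*} [CommRing R] [Algebra ℝ R]
    {Q : Fin n → Camera} {v : Fin n → Fin 3 → R} {y : Fin 4 → R} {c : Fin n → R} :
    triangulationMatrix Q v *ᵥ Sum.elim y c = 0 ↔
      ∀ i, (Q i).mat.map (algebraMap ℝ R) *ᵥ y = c i • v i := by
  have happly : ∀ p : Fin n × Fin 3, (triangulationMatrix Q v *ᵥ Sum.elim y c) p =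
      ((Q p.1).mat.map (algebraMap ℝ R) *ᵥ y) p.2 - (c p.1 • v p.1) p.2 := fun p ↦ by
    change Sum.elim ((Q p.1).mat.map (algebraMap ℝ R) p.2) (Pi.single p.1 (-v p.1 p.2)) ⬝ᵥ
      Sum.elim y c = _
    rw [sumElim_dotProduct_sumElim, single_dotProduct, neg_mul, mul_comm, ← sub_eq_add_neg]
    rfl
  simp only [funext_iff, Prod.forall, happly, Pi.zero_apply, sub_eq_zero]

theorem triangulationMatrix_map {n : ℕ} {R S : Type*} [CommRing R] [Algebra ℝ R] [CommRing S]
    [Algebra ℝ S] (f : R →ₐ[ℝ] S) (Q : Fin n → Camera) (v : Fin n → Fin 3 → R) :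
    (triangulationMatrix Q v).map f = triangulationMatrix Q fun i ↦ f ∘ v i := by
  ext p (k | k)
  · simp [triangulationMatrix]
  · obtain rfl | hk := eq_or_ne k p.1
    · simp [triangulationMatrix]
    · simp [triangulationMatrix, Pi.single_eq_of_ne hk]

/-- A real matrix regarded as a matrix of constant polynomials. -/
noncomputable abbrev polyMatrix {m n : Type*} (A : Matrix m n ℝ) : Matrix m n ℝ[X] :=
  A.map (algebraMap ℝ ℝ[X])

/-- A polynomial solution, along the affine part of the standard twisted cubic, of the problem of
finding a point `Y` that the cameras `T` see where the cameras `M` see the point of the cubic. -/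
structure IsPolynomialTriangulation (M T : Fin 3 → Camera) (Y : Fin 4 → ℝ[X])
    (c : Fin 3 → ℝ[X]) : Prop where
  ne_zero : Y ≠ 0 ∨ c ≠ 0
  mulVec_eq : ∀ i, polyMatrix (T i).mat *ᵥ Y = c i • polyMatrix (M i).mat *ᵥ momentVec 3 1 X

theorem map_comp_mulVec_momentVec {m R S : Type*} {d : ℕ} [CommSemiring R] [Algebra ℝ R]
    [CommSemiring S] [Algebra ℝ S] (f : R →ₐ[ℝ] S) (A : Matrix m (Fin (d + 1)) ℝ) (s t : R) :
    f ∘ (A.map (algebraMap ℝ R) *ᵥ momentVec d s t) =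
      A.map (algebraMap ℝ S) *ᵥ momentVec d (f s) (f t) := by
  ext k
  simp [Matrix.mulVec, dotProduct, momentVec]

theorem exists_isPolynomialTriangulation {M T : Fin 3 → Camera}
    (h : ∀ τ : ℝ, ∃ y ≠ 0, SeesAs M T (momentVec 3 1 (τ : ℂ)) y) :
    ∃ Y c, IsPolynomialTriangulation M T Y c := by
  let S := triangulationMatrix T fun i ↦ polyMatrix (M i).mat *ᵥ momentVec 3 1 X
  obtain ⟨v, hv, hSv⟩ : ∃ v ≠ 0, S *ᵥ v = 0 := by
    refine exists_polynomial_mulVec_eq_zero fun τ ↦ ?_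
    obtain ⟨y, hy, hTy⟩ := h τ
    choose c hc using hTy
    refine ⟨Sum.elim y c, fun h0 ↦ hy (funext fun k ↦ congrFun h0 (Sum.inl k)), ?_⟩
    rw [triangulationMatrix_map, triangulationMatrix_mulVec_eq_zero]
    intro i
    rw [map_comp_mulVec_momentVec, map_one, aeval_X, hc i]
  rw [← Sum.elim_comp_inl_inr v] at hv hSv
  refine ⟨v ∘ Sum.inl, v ∘ Sum.inr, ?_, triangulationMatrix_mulVec_eq_zero.mp hSv⟩
  contrapose! hv
  rw [hv.1, hv.2, Sum.elim_zero_zero]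

/-- The polynomial with given coefficients. -/
noncomputable def coeffPoly (n : ℕ) : (Fin n → ℝ) →ₗ[ℝ] ℝ[X] :=
  (degreeLT ℝ n).subtype ∘ₗ (degreeLTEquiv ℝ n).symm.toLinearMap

theorem coeffPoly_apply {n : ℕ} (v : Fin n → ℝ) :
    coeffPoly n v = ∑ k : Fin n, monomial (k : ℕ) (v k) := rfl

theorem coeffPoly_injective (n : ℕ) : Function.Injective (coeffPoly n) :=
  Subtype.val_injective.comp (degreeLTEquiv ℝ n).symm.injective

theorem range_coeffPoly (n : ℕ) : LinearMap.range (coeffPoly n) = degreeLT ℝ n := by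
  rw [coeffPoly, LinearMap.range_comp, LinearEquiv.range, Submodule.map_top,
    Submodule.range_subtype]

theorem coeffPoly_coeff {n : ℕ} (v : Fin n → ℝ) (k : Fin n) : (coeffPoly n v).coeff k = v k :=
  congrFun ((degreeLTEquiv ℝ n).apply_symm_apply v) k

theorem aeval_coeffPoly {d : ℕ} (v : Fin (d + 1) → ℝ) (z : ℂ) :
    aeval z (coeffPoly (d + 1) v) = complexVec v ⬝ᵥ momentVec d 1 z := by
  simp [coeffPoly_apply, dotProduct, momentVec, aeval_monomial]

theorem polyMatrix_mulVec_momentVec {m : Type*} {d : ℕ} (A : Matrix m (Fin (d + 1)) ℝ) (k : m) :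
    (polyMatrix A *ᵥ momentVec d 1 X) k = coeffPoly (d + 1) (A k) := by
  simp [coeffPoly_apply, Matrix.mulVec, dotProduct, momentVec, C_mul_X_pow_eq_monomial]

theorem polyMatrix_mulVec_momentVec_injective {m : Type*} {d : ℕ} :
    Function.Injective fun A : Matrix m (Fin (d + 1)) ℝ ↦ polyMatrix A *ᵥ momentVec d 1 X := by
  intro A B h
  refine funext fun k ↦ coeffPoly_injective (d + 1) ?_
  rw [← polyMatrix_mulVec_momentVec, ← polyMatrix_mulVec_momentVec]
  exact congrFun h k

theorem coeffPoly_vecMul {m : Type*} [Fintype m] {d : ℕ} (u : m → ℝ)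
    (A : Matrix m (Fin (d + 1)) ℝ) : coeffPoly (d + 1) (u ᵥ* A) =
      (algebraMap ℝ ℝ[X] ∘ u) ⬝ᵥ (polyMatrix A *ᵥ momentVec d 1 X) := by
  simp only [Matrix.vecMul_eq_sum, map_sum, map_smul, dotProduct, polyMatrix_mulVec_momentVec,
    Function.comp_apply, ← Algebra.smul_def]

end Polynomials

theorem mem_span_range_of_forall_dotProduct_eq_zero {ι K n : Type*} [Field K] [Fintype n]
    {u : ι → n → K} {w : n → K} (h : ∀ v, (∀ i, u i ⬝ᵥ v = 0) → w ⬝ᵥ v = 0) :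
    w ∈ Submodule.span K (Set.range u) := by
  classical
  have hmem : dotProductEquiv K n w ∈
      Submodule.span K (Set.range fun i ↦ dotProductEquiv K n (u i)) :=
    FiniteDimensional.mem_span_of_iInf_ker_le_ker fun v hv ↦ h v (by simpa using hv)
  rw [Set.range_comp' (dotProductEquiv K n), ← LinearEquiv.coe_coe, ← Submodule.map_span] at hmem
  obtain ⟨w', hw', heq⟩ := hmem
  rwa [← (dotProductEquiv K n).injective heq]

theorem finrank_ker_mulVecLin_add_card {K m n : Type*} [Field K] [Fintype m] [Fintype n]
    {A : Matrix m n K} (hA : LinearIndependent K A.row) :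
    Module.finrank K (LinearMap.ker A.mulVecLin) + Fintype.card m = Fintype.card n := by
  rw [← hA.rank_matrix, add_comm, Matrix.rank, LinearMap.finrank_range_add_finrank_ker,
    Module.finrank_fintype_fun_eq_card]

theorem exists_linearIndependent_row_mul_transpose_eq_zero {K m n : Type*} [Field K] [Fintype m]
    [Fintype n] {A : Matrix m n K} (hA : LinearIndependent K A.row) {k : ℕ}
    (hcard : k + Fintype.card m = Fintype.card n) :
    ∃ E : Matrix (Fin k) n K, LinearIndependent K E.row ∧ E * Aᵀ = 0 := by
  have hker : Module.finrank K (LinearMap.ker A.mulVecLin) = k :=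
    Nat.add_right_cancel ((finrank_ker_mulVecLin_add_card hA).trans hcard.symm)
  let e := Module.finBasisOfFinrankEq K _ hker
  refine ⟨Matrix.of fun j ↦ (e j).val,
    e.linearIndependent.map' (Submodule.subtype _) (Submodule.ker_subtype _), ?_⟩
  ext j i
  have hej : A *ᵥ (e j).val = 0 := (e j).2
  exact (dotProduct_comm _ _).trans (congrFun hej i)

theorem mem_span_pair_of_mulVec_eq_zero {K : Type*} [Field K] {E : Matrix (Fin 2) (Fin 4) K}
    (hE : LinearIndependent K E.row) {u v w : Fin 4 → K} (hu : E *ᵥ u = 0) (hv : E *ᵥ v = 0)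
    (hw : E *ᵥ w = 0) (huv : LinearIndependent K ![u, v]) : w ∈ Submodule.span K {u, v} :=
  mem_span_pair_of_finrank_eq_two (W := LinearMap.ker E.mulVecLin)
    (Nat.add_right_cancel (finrank_ker_mulVecLin_add_card hE)) hu hv hw huv

section PlaneNets

open Polynomial

/-- The cubics cut out on the standard twisted cubic by the planes through the point `b`. -/
noncomputable def planeNet (b : Fin 4 → ℝ) : Submodule ℝ ℝ[X] :=
  (LinearMap.ker (dotProductEquiv ℝ (Fin 4) b)).map (coeffPoly 4)

theorem mem_planeNet {b : Fin 4 → ℝ} {f : ℝ[X]} :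
    f ∈ planeNet b ↔ ∃ v, b ⬝ᵥ v = 0 ∧ coeffPoly 4 v = f := Iff.rfl

theorem finrank_planeNet {b : Fin 4 → ℝ} (hb : b ≠ 0) : Module.finrank ℝ (planeNet b) = 3 := by
  have hker := Module.Dual.finrank_ker_add_one_of_ne_zero
    ((dotProductEquiv ℝ (Fin 4)).map_ne_zero_iff.mpr hb)
  rw [Module.finrank_fin_fun] at hker
  rw [planeNet, ← (Submodule.equivMapOfInjective _ (coeffPoly_injective 4) _).finrank_eq]
  exact Nat.succ.inj hker

theorem planeNet_sup {b b' : Fin 4 → ℝ} (h : LinearIndependent ℝ ![b, b']) :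
    planeNet b ⊔ planeNet b' = degreeLT ℝ 4 := by
  obtain ⟨v, hv, hv'⟩ : ∃ v, b ⬝ᵥ v = 0 ∧ b' ⬝ᵥ v ≠ 0 := by
    by_contra! hle
    obtain ⟨c, hc⟩ := Submodule.mem_span_singleton.mp <| Set.range_const (ι := Unit) (c := b) ▸
      mem_span_range_of_forall_dotProduct_eq_zero fun v hv ↦ hle v (hv ())
    exact (LinearIndependent.pair_iff' (h.ne_zero 0)).mp h c hc
  rw [planeNet, planeNet, ← Submodule.map_sup, ← range_coeffPoly, ← Submodule.map_top]
  congr 1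
  refine eq_top_iff.mpr fun w _ ↦ ?_
  rw [← sub_add_cancel w ((b' ⬝ᵥ w / b' ⬝ᵥ v) • v), add_comm]
  refine Submodule.add_mem_sup ?_ ?_
  · simp [hv]
  · simp [hv']

theorem natDegree_coeffPoly_le {d : ℕ} (v : Fin (d + 1) → ℝ) :
    (coeffPoly (d + 1) v).natDegree ≤ d := by
  have hv : coeffPoly (d + 1) v ∈ degreeLT ℝ (d + 1) :=
    range_coeffPoly (d + 1) ▸ LinearMap.mem_range_self _ v
  rwa [degreeLT_succ_eq_degreeLE, mem_degreeLE, ← natDegree_le_iff_degree_le] at hv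

theorem coprimeForms_coeffPoly {p r : Fin 4 → ℝ} (h : ∀ s t : ℂ, s ≠ 0 ∨ t ≠ 0 →
    complexVec p ⬝ᵥ momentVec 3 s t = 0 → complexVec r ⬝ᵥ momentVec 3 s t ≠ 0) :
    CoprimeForms 3 (coeffPoly 4 p) (coeffPoly 4 r) where
  isCoprime := by
    rw [isCoprime_iff_aeval_ne_zero_of_isAlgClosed ℝ ℂ]
    intro z
    rw [aeval_coeffPoly, aeval_coeffPoly]
    exact not_and_or.mp fun hz ↦ h 1 z (.inl one_ne_zero) hz.1 hz.2
  natDegree_left_le := natDegree_coeffPoly_le p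
  natDegree_right_le := natDegree_coeffPoly_le r
  coeff_ne_zero := by
    have hinfty (v : Fin 4 → ℝ) : complexVec v ⬝ᵥ momentVec 3 0 1 = (coeffPoly 4 v).coeff 3 := by
      rw [show (coeffPoly 4 v).coeff 3 = v 3 from coeffPoly_coeff v 3]
      simp [dotProduct, Fin.sum_univ_four, momentVec]
    have h01 := h 0 1 (.inr one_ne_zero)
    rw [hinfty, hinfty, Complex.ofReal_eq_zero, Ne, Complex.ofReal_eq_zero] at h01
    exact not_and_or.mp fun h0 ↦ h01 h0.1 h0.2

theorem CollinearCameras.exists_netTriple {M : Fin 3 → Camera} {b : Fin 3 → Fin 4 → ℝ}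
    (h : CollinearCameras M b) : ∃ n m, NetTriple (fun i ↦ planeNet (b i)) n m := by
  have h01 := h.indep 0 1 (by decide)
  obtain ⟨E, hE, hEb⟩ := exists_linearIndependent_row_mul_transpose_eq_zero
    (A := Matrix.of ![b 0, b 1]) h01 (k := 2) rfl
  have horth (i : Fin 3) : E *ᵥ b i = 0 := by
    obtain ⟨x, y, hxy⟩ := Submodule.mem_span_pair.mp (h.collinear 0 1 i (by decide))
    have h0 : E *ᵥ b 0 = 0 := funext fun j ↦ congrFun (congrFun hEb j) 0
    have h1 : E *ᵥ b 1 = 0 := funext fun j ↦ congrFun (congrFun hEb j) 1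
    rw [← hxy, Matrix.mulVec_add, Matrix.mulVec_smul, Matrix.mulVec_smul, h0, h1, smul_zero,
      smul_zero, add_zero]
  have horth' (i : Fin 3) : E.toComplex *ᵥ complexVec (b i) = 0 := by
    rw [complexVec_mulVec, horth, complexVec_eq_zero]
  have hrow (j : Fin 2) (i : Fin 3) : coeffPoly 4 (E j) ∈ planeNet (b i) :=
    mem_planeNet.mpr ⟨_, (dotProduct_comm _ _).trans (congrFun (horth i) j), rfl⟩
  refine ⟨coeffPoly 4 (E 0), coeffPoly 4 (E 1), ?_, hrow 0, hrow 1,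
    fun i ↦ finrank_planeNet (h.center_ne_zero i), fun i j hij ↦ planeNet_sup (h.indep i j hij)⟩
  refine coprimeForms_coeffPoly fun s t hst hs ht ↦ h.disjoint 0 1 s t hst ?_
  refine mem_span_pair_of_mulVec_eq_zero (linearIndependent_algebraMap_comp_iff.mpr hE)
    (horth' 0) (horth' 1) (funext fun j ↦ ?_) (linearIndependent_complexVec_pair.mpr h01)
  fin_cases j
  exacts [hs, ht]

end PlaneNets

theorem Camera.exists_left_inv {P Q : Camera} (h : P.center ≠ Q.center) :
    ∃ G G' : Matrix (Fin 4) (Fin 3) ℝ, G * P.mat + G' * Q.mat = 1 := by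
  have hker : LinearMap.ker (Matrix.fromRows P.mat Q.mat).mulVecLin = ⊥ := by
    refine LinearMap.ker_eq_bot'.mpr fun v hv ↦ by_contra fun hv0 ↦ h ?_
    have hPQ : Sum.elim (P.mat *ᵥ v) (Q.mat *ᵥ v) = 0 := (Matrix.fromRows_mulVec ..).symm.trans hv
    have hcenter {K : Camera} (hK : K.mat *ᵥ v = 0) : K.center =
        Projectivization.mk ℂ (complexVec v) (complexVec_eq_zero.not.mpr hv0) :=
      Camera.center_eq_mk _ (by rw [complexVec_mulVec, hK, complexVec_eq_zero])
    rw [hcenter (K := P) (funext fun k ↦ congrFun hPQ (.inl k)),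
      hcenter (K := Q) (funext fun k ↦ congrFun hPQ (.inr k))]
  obtain ⟨g, hg⟩ := LinearMap.exists_leftInverse_of_injective _ hker
  have hleft : LinearMap.toMatrix' g * Matrix.fromRows P.mat Q.mat = 1 := by
    have hmat := congrArg LinearMap.toMatrix' hg
    rwa [LinearMap.toMatrix'_comp, LinearMap.toMatrix'_id, ← Matrix.toLin'_apply',
      LinearMap.toMatrix'_toLin'] at hmat
  refine ⟨(LinearMap.toMatrix' g).toCols₁, (LinearMap.toMatrix' g).toCols₂, ?_⟩
  rwa [← Matrix.fromCols_mul_fromRows, Matrix.fromCols_toCols]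

theorem CollinearCameras.exists_vecMul_eq {M : Fin 3 → Camera} {b : Fin 3 → Fin 4 → ℝ}
    (h : CollinearCameras M b) (i : Fin 3) {v : Fin 4 → ℝ} (hv : b i ⬝ᵥ v = 0) :
    ∃ u, u ᵥ* (M i).mat = v := by
  have hmem : v ∈ Submodule.span ℝ (Set.range (M i).mat.row) := by
    refine mem_span_range_of_forall_dotProduct_eq_zero fun x hx ↦ ?_
    obtain ⟨c, rfl⟩ := h.exists_eq_smul_real i (funext hx)
    rw [dotProduct_smul, dotProduct_comm, hv, smul_zero]
  rwa [← range_vecMulLinear] at hmem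

section Multipliers

open Polynomial

theorem polyMatrix_mulVec_momentVec_eq_zero {m : Type*} {d : ℕ} {A : Matrix m (Fin (d + 1)) ℝ} :
    polyMatrix A *ᵥ momentVec d 1 X = 0 ↔ A = 0 := by
  rw [← polyMatrix_mulVec_momentVec_injective.eq_iff (b := 0)]
  simp

theorem Camera.polyMatrix_mulVec_momentVec_ne_zero (P : Camera) :
    polyMatrix P.mat *ᵥ momentVec 3 1 X ≠ 0 := by
  intro h
  have hP := P.full_rank
  rw [polyMatrix_mulVec_momentVec_eq_zero.mp h, Matrix.rank_zero] at hP
  exact absurd hP (by decide)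

theorem linearIndependent_row_of_polyMatrix {d : ℕ} {q : ℝ[X]}
    {B : Matrix (Fin 4) (Fin (d + 1)) ℝ}
    (hB : LinearIndependent ℝ (q • polyMatrix B *ᵥ momentVec d 1 X)) :
    LinearIndependent ℝ B.row := by
  have hrow : q • polyMatrix B *ᵥ momentVec d 1 X =
      (LinearMap.mulLeft ℝ q ∘ₗ coeffPoly (d + 1)) ∘ B.row :=
    funext fun k ↦ congrArg (q * ·) (polyMatrix_mulVec_momentVec B k)
  exact LinearIndependent.of_comp _ (hrow ▸ hB)

theorem det_ne_zero_of_linearIndependent_linForm {l l' : Fin 2 → ℝ}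
    (h : LinearIndependent ℝ ![linForm l 1 (X : ℝ[X]), linForm l' 1 X]) :
    l 0 * l' 1 - l 1 * l' 0 ≠ 0 := by
  intro hdet
  have hX : C (l 0) * C (l' 1) - C (l 1) * C (l' 0) = 0 := by
    rw [← C_mul, ← C_mul, ← C_sub, hdet, C_0]
  have hl : ∀ k, l k = 0 := by
    refine fun k ↦ neg_eq_zero.mp (LinearIndependent.pair_iff.mp h (l' k) (-l k) ?_).2
    simp only [linForm, smul_eq_C_mul, algebraMap_eq, C_neg]
    revert k
    exact Fin.forall_fin_two.mpr
      ⟨by linear_combination -X * hX, by linear_combination hX⟩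
  exact h.ne_zero 0 (by simp [linForm, hl])

namespace IsPolynomialTriangulation

variable {M T : Fin 3 → Camera} {b : Fin 3 → Fin 4 → ℝ} {Y : Fin 4 → ℝ[X]} {c : Fin 3 → ℝ[X]}
  {i j : Fin 3}

theorem eq_add (h : IsPolynomialTriangulation M T Y c) {G G' : Matrix (Fin 4) (Fin 3) ℝ}
    (hG : G * (T i).mat + G' * (T j).mat = 1) :
    Y = c i • polyMatrix (G * (M i).mat) *ᵥ momentVec 3 1 X +
      c j • polyMatrix (G' * (M j).mat) *ᵥ momentVec 3 1 X := by
  have hone : polyMatrix (1 : Matrix (Fin 4) (Fin 4) ℝ) *ᵥ Y = Y := by simp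
  rw [← map_mulVec_map_mulVec, ← map_mulVec_map_mulVec, ← Matrix.mulVec_smul (polyMatrix G),
    ← Matrix.mulVec_smul (polyMatrix G'), ← h.mulVec_eq, ← h.mulVec_eq, map_mulVec_map_mulVec,
    map_mulVec_map_mulVec, ← Matrix.add_mulVec, ← Matrix.map_add _ (map_add _), hG, hone]

theorem multiplier_ne_zero_or (h : IsPolynomialTriangulation M T Y c)
    (hij : (T i).center ≠ (T j).center) : c i ≠ 0 ∨ c j ≠ 0 := by
  by_contra! h0
  obtain ⟨G, G', hG⟩ := Camera.exists_left_inv hij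
  have hY : Y = 0 := by rw [h.eq_add hG, h0.1, h0.2, zero_smul, zero_smul, add_zero]
  refine h.ne_zero.elim (· hY) (· (funext fun k ↦ ?_))
  have hk := h.mulVec_eq k
  rw [hY, Matrix.mulVec_zero, eq_comm, smul_eq_zero] at hk
  exact hk.resolve_right (M k).polyMatrix_mulVec_momentVec_ne_zero

theorem multiplier_ne_zero (h : IsPolynomialTriangulation M T Y c)
    (hij : (T i).center ≠ (T j).center) : c i ≠ 0 := by
  intro hi
  have hj : c j ≠ 0 := (h.multiplier_ne_zero_or hij).resolve_left (not_not_intro hi)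
  obtain ⟨G, G', hG⟩ := Camera.exists_left_inv hij
  have hY : Y = c j • polyMatrix (G' * (M j).mat) *ᵥ momentVec 3 1 X := by
    rw [h.eq_add hG, hi, zero_smul, zero_add]
  have hTi : (T i).mat * (G' * (M j).mat) = 0 := by
    have hYi := h.mulVec_eq i
    rw [hY, hi, zero_smul, Matrix.mulVec_smul, map_mulVec_map_mulVec] at hYi
    exact polyMatrix_mulVec_momentVec_eq_zero.mp ((smul_eq_zero_iff_right hj).mp hYi)
  have hTj : (T j).mat * (G' * (M j).mat) = (M j).mat := by
    have hYj := h.mulVec_eq j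
    rw [hY, Matrix.mulVec_smul, map_mulVec_map_mulVec] at hYj
    exact polyMatrix_mulVec_momentVec_injective (smul_right_injective _ hj hYj)
  have hle := Matrix.rank_add_rank_le_card_of_mul_eq_zero hTi
  have hge := Matrix.rank_mul_le_right (T j).mat (G' * (M j).mat)
  rw [(T i).full_rank, Fintype.card_fin] at hle
  rw [hTj, (M j).full_rank] at hge
  omega

theorem mul_mem (h : IsPolynomialTriangulation M T Y c) (hM : CollinearCameras M b) (i : Fin 3)
    {f : ℝ[X]} (hf : f ∈ planeNet (b i)) : c i * f ∈ Submodule.span ℝ (Set.range Y) := by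
  obtain ⟨v, hv, rfl⟩ := mem_planeNet.mp hf
  obtain ⟨u, rfl⟩ := hM.exists_vecMul_eq i hv
  rw [coeffPoly_vecMul, ← smul_eq_mul, ← dotProduct_smul, ← h.mulVec_eq]
  simp only [dotProduct, Matrix.mulVec, Function.comp_apply, Matrix.map_apply, ← Algebra.smul_def]
  exact Submodule.sum_mem _ fun a _ ↦ Submodule.smul_mem _ _ <|
    Submodule.sum_mem _ fun k _ ↦ Submodule.smul_mem _ _ (Submodule.subset_span ⟨k, rfl⟩)

theorem isMultiplierTriple (h : IsPolynomialTriangulation M T Y c) (hM : CollinearCameras M b)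
    (hT : Function.Injective fun i ↦ (T i).center) :
    IsMultiplierTriple (fun i ↦ planeNet (b i)) (Submodule.span ℝ (Set.range Y)) c where
  ne_zero i := h.multiplier_ne_zero (hT.ne (a₁ := i) (a₂ := i + 1) (by decide +revert))
  mul_mem i _ := h.mul_mem hM i
  finiteDimensional := FiniteDimensional.span_of_finite ℝ (Set.finite_range Y)
  finrank_le := finrank_range_le_card (R := ℝ) Y

theorem exists_factorization (h : IsPolynomialTriangulation M T Y c)
    (hT : (T i).center ≠ (T j).center) {d : ℕ} {q : ℝ[X]} (hq : q ≠ 0)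
    {S : Fin 3 → Matrix (Fin 4) (Fin (d + 1)) ℝ}
    (hS : ∀ k, c k • momentVec 3 1 X = q • polyMatrix (S k) *ᵥ momentVec d 1 X) :
    ∃ B, Y = q • polyMatrix B *ᵥ momentVec d 1 X ∧ ∀ k, (T k).mat * B = (M k).mat * S k := by
  have hshift (k : Fin 3) {m : Type} (K : Matrix m (Fin 4) ℝ) :
      c k • polyMatrix K *ᵥ momentVec 3 1 X = q • polyMatrix (K * S k) *ᵥ momentVec d 1 X := by
    rw [← map_mulVec_map_mulVec, ← Matrix.mulVec_smul, hS, Matrix.mulVec_smul]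
  obtain ⟨G, G', hG⟩ := Camera.exists_left_inv hT
  have hY := h.eq_add hG
  rw [hshift, hshift, ← smul_add, ← Matrix.add_mulVec, ← Matrix.map_add _ (map_add _)] at hY
  refine ⟨_, hY, fun k ↦ ?_⟩
  have hk := h.mulVec_eq k
  rw [hY, Matrix.mulVec_smul, map_mulVec_map_mulVec, hshift] at hk
  exact polyMatrix_mulVec_momentVec_injective (smul_right_injective _ hq hk)

theorem exists_quarticModel (h : IsPolynomialTriangulation M T Y c)
    (hij : (T i).center ≠ (T j).center) (hY : LinearIndependent ℝ Y) {q : ℝ[X]}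
    {w : Fin 3 → ℝ[X]} (hq : q ≠ 0) (hc : ∀ k, (w k).natDegree ≤ 1 ∧ c k = q * w k)
    (hw : ∀ k k', k ≠ k' → LinearIndependent ℝ ![w k, w k']) :
    ∃ B l, QuarticModel M T B l := by
  let l (k : Fin 3) : Fin 2 → ℝ := ![(w k).coeff 0, (w k).coeff 1]
  have hl (k) : w k = linForm (l k) 1 X := by
    conv_lhs => rw [eq_X_add_C_of_natDegree_le_one (hc k).1]
    simp [l, linForm, add_comm]
  obtain ⟨B, rfl, hB⟩ := h.exists_factorization hij hq (S := fun k ↦ shiftMatrix (l k)) fun k ↦ by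
    rw [shiftMatrix_mulVec_momentVec, ← hl, (hc k).2, mul_smul]
  exact ⟨B, l, hB, linearIndependent_row_of_polyMatrix hY, fun k k' hkk' ↦
    det_ne_zero_of_linearIndependent_linForm (hl k ▸ hl k' ▸ hw k k' hkk')⟩

theorem exists_mul_eq_smul (h : IsPolynomialTriangulation M T Y c)
    (hij : (T i).center ≠ (T j).center) {q : ℝ[X]} (hq : q ≠ 0) {z : Fin 3 → ℝ}
    (hc : ∀ k, c k = z k • q) :
    ∃ H : Matrix (Fin 4) (Fin 4) ℝ, ∀ k, (T k).mat * H = z k • (M k).mat := by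
  obtain ⟨H, -, hH⟩ := h.exists_factorization hij hq (S := fun k ↦ z k • 1) (d := 3) fun k ↦ by
    rw [hc, smul_assoc, smul_comm, polyMatrix,
      Matrix.map_smul (algebraMap ℝ ℝ[X]) _ ((Algebra.linearMap ℝ ℝ[X]).map_smul _),
      Matrix.map_one _ (map_zero _) (map_one _), Matrix.smul_mulVec, Matrix.one_mulVec]
  exact ⟨H, fun k ↦ by rw [hH, Matrix.mul_smul, Matrix.mul_one]⟩

end IsPolynomialTriangulation

theorem CollinearCameras.exists_quarticModel_or_exists_mul_eq_smul
    {M T : Fin 3 → Camera} {b : Fin 3 → Fin 4 → ℝ}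
    (hM : CollinearCameras M b) (hT : Function.Injective fun i ↦ (T i).center)
    (h : ∀ τ : ℝ, ∃ y ≠ 0, SeesAs M T (momentVec 3 1 (τ : ℂ)) y) :
    (∃ B l, QuarticModel M T B l) ∨ ∃ (H : Matrix (Fin 4) (Fin 4) ℝ) (z : Fin 3 → ℝ),
      ∀ i, z i ≠ 0 ∧ (T i).mat * H = z i • (M i).mat := by
  obtain ⟨Y, c, hY⟩ := exists_isPolynomialTriangulation h
  obtain ⟨n, m, hN⟩ := hM.exists_netTriple
  have hc := hY.isMultiplierTriple hM hT
  have h01 := hT.ne (show (0 : Fin 3) ≠ 1 by decide)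
  rcases hN.eq_smul_or_exists_linear_factorization hc with
    ⟨z, hz⟩ | ⟨hrank, q, w, hq, hw, hindep⟩
  · obtain ⟨H, hH⟩ := hY.exists_mul_eq_smul h01 (hc.ne_zero 0) hz
    refine .inr ⟨H, z, fun i ↦ ⟨fun hi ↦ hc.ne_zero i ?_, hH i⟩⟩
    rw [hz, hi, zero_smul]
  · exact .inl (hY.exists_quarticModel h01
      (linearIndependent_iff_card_eq_finrank_span.mpr hrank.symm) hq hw hindep)

end Multipliers

theorem Camera.mul_inv_eq_smul {P Q : Camera} {H : GL (Fin 4) ℝ} {z : ℝ} (hz : z ≠ 0)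
    (h : Q.mat * H.val = z • P.mat) : P.mat * (H⁻¹).val = z⁻¹ • Q.mat := by
  rw [← inv_smul_smul₀ hz P.mat, ← h, Matrix.smul_mul, Matrix.mul_assoc, Units.mul_inv,
    Matrix.mul_one]

namespace CollinearCameras

variable {M T : Fin 3 → Camera} {b : Fin 3 → Fin 4 → ℝ}

theorem eq_smul_of_seesAs_self (h : CollinearCameras M b) {s t : ℂ} (hst : s ≠ 0 ∨ t ≠ 0)
    {w : Fin 4 → ℂ} (hw : SeesAs M M (momentVec 3 s t) w) : ∃ c : ℂ, w = c • momentVec 3 s t := by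
  have hline (i : Fin 3) : ∃ c d : ℂ, w - c • momentVec 3 s t = d • complexVec (b i) := by
    obtain ⟨c, hc⟩ := hw i
    refine ⟨c, h.exists_eq_smul i ?_⟩
    rw [Matrix.mulVec_sub, Matrix.mulVec_smul, hc, sub_self]
  obtain ⟨c, d, hcd⟩ := hline 0
  obtain ⟨c', d', hcd'⟩ := hline 1
  have hcc' : c - c' = 0 := by
    by_contra hne
    refine h.disjoint 0 1 s t hst ((Submodule.smul_mem_iff _ hne).mp ?_)
    exact Submodule.mem_span_pair.mpr
      ⟨-d, d', by linear_combination (norm := module) hcd - hcd'⟩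
  have hd := (LinearIndependent.pair_iff.mp
    (linearIndependent_complexVec_pair.mpr (h.indep 0 1 (by decide))) d (-d') (by
      rw [sub_eq_zero.mp hcc'] at hcd
      linear_combination (norm := module) hcd' - hcd)).1
  exact ⟨c, sub_eq_zero.mp (by rw [hcd, hd, zero_smul])⟩

theorem isUnit_of_mul_eq_smul (h : CollinearCameras M b) {H : Matrix (Fin 4) (Fin 4) ℝ}
    {z : Fin 3 → ℝ} (hH : ∀ i, z i ≠ 0 ∧ (T i).mat * H = z i • (M i).mat) : IsUnit H := by
  refine Matrix.mulVec_injective_iff_isUnit.mp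
    ((injective_iff_map_eq_zero H.mulVecLin).mpr fun v (hv : H *ᵥ v = 0) ↦ ?_)
  have hker (i : Fin 3) : ∃ c : ℝ, v = c • b i := by
    refine h.exists_eq_smul_real i ((smul_eq_zero_iff_right (hH i).1).mp ?_)
    rw [← Matrix.smul_mulVec, ← (hH i).2, ← Matrix.mulVec_mulVec, hv, Matrix.mulVec_zero]
  obtain ⟨c, hc⟩ := hker 0
  obtain ⟨c', hc'⟩ := hker 1
  have hc0 := (LinearIndependent.pair_iff.mp (h.indep 0 1 (by decide)) c (-c')
    (by rw [neg_smul, ← hc, ← hc', add_neg_cancel])).1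
  rw [hc, hc0, zero_smul]

theorem eq_smul_of_mul_eq_smul (h : CollinearCameras M b) {H : GL (Fin 4) ℝ} {z : Fin 3 → ℝ}
    (hH : ∀ i, z i ≠ 0 ∧ (T i).mat * H.val = z i • (M i).mat) {s t : ℂ} (hst : s ≠ 0 ∨ t ≠ 0)
    {y : Fin 4 → ℂ} (hy : SeesAs M T (momentVec 3 s t) y) :
    ∃ c : ℂ, y = c • H.val.toComplex *ᵥ momentVec 3 s t := by
  have hHy : H.val.toComplex *ᵥ ((H⁻¹).val.toComplex *ᵥ y) = y := by
    rw [map_mulVec_map_mulVec, Units.mul_inv]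
    simp
  obtain ⟨c, hc⟩ := h.eq_smul_of_seesAs_self hst (w := (H⁻¹).val.toComplex *ᵥ y) fun i ↦ by
    obtain ⟨c, hc⟩ := hy i
    refine ⟨(z i)⁻¹ • c, ?_⟩
    rw [smul_assoc, ← hc, map_mulVec_map_mulVec, Camera.mul_inv_eq_smul (hH i).1 (hH i).2,
      Matrix.map_smul (algebraMap ℝ ℂ) _ ((Algebra.linearMap ℝ ℂ).map_smul _), Matrix.smul_mulVec]
  exact ⟨c, by rw [← hHy, hc, Matrix.mulVec_smul]⟩

end CollinearCameras

theorem projTransform_image_paramCurve {d : ℕ} (K : GL (Fin 4) ℝ)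
    (B : Matrix (Fin 4) (Fin (d + 1)) ℝ) :
    projTransform K '' paramCurve d B = paramCurve d (K.val * B) := by
  have hK (s t : ℂ) : K.val.toComplex *ᵥ (B.toComplex *ᵥ momentVec d s t) =
      (K.val * B).toComplex *ᵥ momentVec d s t := map_mulVec_map_mulVec ..
  ext x
  constructor
  · rintro ⟨_, ⟨s, t, h, hst, rfl⟩, rfl⟩
    refine ⟨s, t, ?_, hst, ?_⟩
    · rw [← hK]
      exact fun h0 ↦ h (toComplex_mulVec_injective K (h0.trans (Matrix.mulVec_zero _).symm))
    · exact (Projectivization.map_mk ..).trans (by congr 1; exact hK s t)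
  · rintro ⟨s, t, h, hst, rfl⟩
    have hB : B.toComplex *ᵥ momentVec d s t ≠ 0 := fun h0 ↦ h (by
      rw [← hK, h0, Matrix.mulVec_zero])
    exact ⟨_, ⟨s, t, hB, hst, rfl⟩,
      (Projectivization.map_mk ..).trans (by congr 1; exact hK s t)⟩

/-- The cameras `T` see the points of `R` as the cameras `M` see those of the standard twisted
cubic. -/
structure SeesAsTwistedCubic (M T : Fin 3 → Camera) (R : Set Space) : Prop where
  exists_mem : ∀ s t : ℂ, s ≠ 0 ∨ t ≠ 0 → ∃ (y : Fin 4 → ℂ) (hy : y ≠ 0),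
    Projectivization.mk ℂ y hy ∈ R ∧ SeesAs M T (momentVec 3 s t) y
  exists_seesAs : ∀ (y : Fin 4 → ℂ) (hy : y ≠ 0), Projectivization.mk ℂ y hy ∈ R →
    ∃ s t : ℂ, (s ≠ 0 ∨ t ≠ 0) ∧ SeesAs M T (momentVec 3 s t) y

theorem SeesAsTwistedCubic.eq_paramCurve {M T : Fin 3 → Camera} {R : Set Space}
    (h : SeesAsTwistedCubic M T R) {d : ℕ} {B : Matrix (Fin 4) (Fin (d + 1)) ℝ}
    (hB : ∀ {s t : ℂ}, s ≠ 0 ∨ t ≠ 0 → ∀ {y : Fin 4 → ℂ}, SeesAs M T (momentVec 3 s t) y →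
      ∃ c : ℂ, y = c • B.toComplex *ᵥ momentVec d s t) : R = paramCurve d B := by
  have hB0 {s t c : ℂ} {y : Fin 4 → ℂ} (hy : y ≠ 0)
      (hc : y = c • B.toComplex *ᵥ momentVec d s t) : B.toComplex *ᵥ momentVec d s t ≠ 0 :=
    fun h0 ↦ hy (by rw [hc, h0, smul_zero])
  ext x
  constructor
  · induction x using Projectivization.ind with
    | h y hy =>
      intro hyR
      obtain ⟨s, t, hst, hsees⟩ := h.exists_seesAs y hy hyR
      obtain ⟨c, hc⟩ := hB hst hsees
      exact ⟨s, t, hB0 hy hc, hst, projectivization_mk_eq_of_eq_smul _ _ hc⟩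
  · rintro ⟨s, t, hst0, hst, rfl⟩
    obtain ⟨y, hy, hyR, hsees⟩ := h.exists_mem s t hst
    obtain ⟨c, hc⟩ := hB hst hsees
    rwa [← projectivization_mk_eq_of_eq_smul hy hst0 hc]

section Conjugates

variable {P T : CameraTuple 3} {A : GL (Fin 4) ℝ} {b : Fin 3 → Fin 4 → ℝ} {R : Set Space}

theorem CollinearCameras.seesAsTwistedCubic
    (hM : CollinearCameras (fun i ↦ (P.cam i).changeCoords A) b) {S : Set (Fin 3 → Image)}
    (hP : IsReconstruction S P (paramCurve 3 A.val)) (hT : IsReconstruction S T R) :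
    SeesAsTwistedCubic (fun i ↦ (P.cam i).changeCoords A) T.cam R := by
  have hPA {s t : ℂ} (hst : s ≠ 0 ∨ t ≠ 0) (i : Fin 3) :
      (P.cam i).mat.toComplex *ᵥ (A.val.toComplex *ᵥ momentVec 3 s t) ≠ 0 := by
    rw [map_mulVec_map_mulVec]
    exact hM.mulVec_momentVec_ne_zero i hst
  constructor
  · intro s t hst
    have hA : A.val.toComplex *ᵥ momentVec 3 s t ≠ 0 := fun h0 ↦
      hPA hst 0 (by rw [h0, Matrix.mulVec_zero])
    obtain ⟨z, hz, hPz⟩ := hP.2 _ ⟨s, t, hA, hst, rfl⟩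
    obtain ⟨x, hx, hTz⟩ := hT.1 z hz
    induction x using Projectivization.ind with
    | h y hy => exact ⟨y, hy, hx, seesAs_changeCoords.mpr
        (CameraTuple.seesAs_of_sees_mk hA hy (hPA hst) hPz hTz)⟩
  · intro y hy hyR
    obtain ⟨z, hz, hTz⟩ := hT.2 _ hyR
    obtain ⟨x, ⟨s, t, hA, hst, rfl⟩, hPz⟩ := hP.1 z hz
    exact ⟨s, t, hst, seesAs_changeCoords.mpr
      (CameraTuple.seesAs_of_sees_mk hA hy (hPA hst) hPz hTz)⟩

theorem SeesAsTwistedCubic.configEquiv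
    (h : SeesAsTwistedCubic (fun i ↦ (P.cam i).changeCoords A) T.cam R)
    (hM : CollinearCameras (fun i ↦ (P.cam i).changeCoords A) b)
    {H : Matrix (Fin 4) (Fin 4) ℝ} {z : Fin 3 → ℝ}
    (hH : ∀ i, z i ≠ 0 ∧ (T.cam i).mat * H = z i • ((P.cam i).changeCoords A).mat) :
    ConfigEquiv P (paramCurve 3 A.val) T R := by
  obtain ⟨H, rfl⟩ := hM.isUnit_of_mul_eq_smul hH
  refine ⟨H * A⁻¹, ?_, fun i ↦ ⟨(z i)⁻¹, inv_ne_zero (hH i).1, ?_⟩⟩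
  · rw [projTransform_image_paramCurve, ← Units.val_mul, inv_mul_cancel_right]
    exact (h.eq_paramCurve (hM.eq_smul_of_mul_eq_smul hH)).symm
  · rw [mul_inv_rev, inv_inv, Units.val_mul, ← Matrix.mul_assoc]
    exact Camera.mul_inv_eq_smul (hH i).1 (hH i).2

theorem IsConjugate.isRationalQuartic_and_center_mem
    (hM : CollinearCameras (fun i ↦ (P.cam i).changeCoords A) b)
    (h : IsConjugate P (paramCurve 3 A.val) T R) :
    IsRationalQuartic R ∧ ∀ i, (T.cam i).center ∈ R := by
  obtain ⟨⟨S, hP, hT⟩, hequiv⟩ := h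
  have hsees := hM.seesAsTwistedCubic hP hT
  rcases hM.exists_quarticModel_or_exists_mul_eq_smul T.distinct_centers fun τ ↦
    let ⟨y, hy, _, hMT⟩ := hsees.exists_mem 1 τ (.inl one_ne_zero); ⟨y, hy, hMT⟩ with
    ⟨B, l, hB⟩ | ⟨H, z, hH⟩
  · rw [hsees.eq_paramCurve (hB.eq_smul_of_seesAs hM)]
    exact ⟨hB.isRationalQuartic hM, hB.center_mem_paramCurve hM⟩
  · exact absurd (hsees.configEquiv hM hH) hequiv

end Conjugates

theorem mainTheorem8 (P : CameraTuple 3) (L C : Set Space)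
    (hL : IsLine L) (hPL : ∀ i, (P.cam i).center ∈ L)
    (hC : IsTwistedCubic C) (hdisj : Disjoint C L) :
    -- every set of points on the cubic gives a critical configuration
    (∀ X ⊆ C, IsCritical P X) ∧
    -- the whole cubic has a conjugate, which restricts to conjugates of all its subsets
    (∃ (Q : CameraTuple 3) (R : Set Space), IsNontrivialConjugate P C Q R ∧
      ∀ X ⊆ C, ∃ Y ⊆ R, IsNontrivialConjugate P X Q Y) ∧
    -- any conjugate of the whole cubic is a rational quartic through the conjugate centers
    (∀ (Q : CameraTuple 3) (R : Set Space), IsConjugate P C Q R →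
      IsRationalQuartic R ∧ ∀ i, (Q.cam i).center ∈ R) := by
  obtain ⟨A, b, hM, rfl⟩ := exists_collinearCameras hL hPL hC hdisj
  obtain ⟨T, B, l, hT⟩ := hM.exists_quarticModel
  have hconj (X : Set Space) (hX : X ⊆ paramCurve 3 A.val) :
      IsNontrivialConjugate P X T (pointsOver A.val B X) := hT.isNontrivialConjugate hM hX
  refine ⟨fun X hX ↦ ⟨T, _, hconj X hX⟩, ?_, fun Q R ↦ ?_⟩
  · exact ⟨T, _, hconj _ subset_rfl, fun X hX ↦ ⟨_, pointsOver_mono hX, hconj X hX⟩⟩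
  · exact IsConjugate.isRationalQuartic_and_center_mem hM
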